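/- Let $W\subseteq\mathbb{R}^n$ be open and convex with $\mathbb{R}^n_+\subseteq W$, and let $f,g:W\to\mathbb{R}^n$ be continuously differentiable. Assume that $f$ is cooperative on $\mathbb{R}^n_+$ (that is, $\partial f_i/\partial x_j(a)\ge 0$ for all $i\ne j$ and $a\in\mathbb{R}^n_+$), that $g$ is order-preserving on $\mathbb{R}^n_+$ (that is, $g(x)\le g(y)$ whenever $x,y\in\mathbb{R}^n_+$ and $x\le y$, inequalities between vectors being componentwise), and that for some $\alpha>0$ both are sub-homogeneous of degree $\alpha$ on $\mathbb{R}^n_+$ (that is, $f(\lambda x)\le\lambda^\alpha f(x)$ and $g(\lambda x)\le\lambda^\alpha g(x)$ for all $x\in\mathbb{R}^n_+$ and $\lambda\ge 1$). For $\tau_{\max}\ge 0$ and continuous delays $\tau^i_j:[0,\infty)\to[0,\tau_{\max}]$, $1\le i,j\le n$, consider $$\dot x_i(t)=f_i(x(t))+g_i\bigl(x_1(t-\tau^i_1(t)),\dots,x_n(t-\tau^i_n(t))\bigr)\quad (t\ge 0),\qquad x(t)=\varphi(t)\quad (t\in[-\tau_{\max},0]),\tag{1}$$ with continuous initial conditions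 $\varphi:[-\tau_{\max},0]\to\mathbb{R}^n_+$. A point $x^\star\in\mathbb{R}^n_+$ with $f(x^\star)+g(x^\star)=0$ is called a globally asymptotically stable equilibrium of (1) if for every such $\varphi$ the solution exists for all $t\ge 0$ and converges to $x^\star$ as $t\to\infty$, and if for every $\varepsilon>0$ there is $\delta>0$ such that $\|\varphi(t)-x^\star\|<\delta$ for all $t\in[-\tau_{\max},0]$ implies $\|x(t)-x^\star\|<\varepsilon$ for all $t\ge 0$. Then, for every $x^\star\in\mathbb{R}^n$, the following are equivalent: (a) $x^\star$ is a globally asymptotically stable equilibrium of the system without delay, $\dot x=f(x)+g(x)$ (that is, (1) with $\tau_{\max}=0$); (b) $x^\star$ is a globally asymptotically stable equilibrium of (1) for all $\tau_{\max}\ge 0$ and all continuous delays $\tau^i_j:[0,\infty)\to[0,\tau_{\max}]$; (c) $x^\star$ is a globally asymptotically stable equilibrium of (1) for some $\tau_{\max}\ge 0$ and some continuous delays $\tau^i_j:[0,\infty)\to[0,\tau_{\max}]$. -/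

import Mathlib

open Set Filter Topology

namespace DelaySystem

/-- The nonnegative orthant `ℝⁿ₊`. -/
def orthant (n : ℕ) : Set (Fin n → ℝ) := {x | ∀ i, 0 ≤ x i}

/-- The Jacobian matrix of `f` at `a`: the entry `(i, j)` is `∂fᵢ/∂xⱼ (a)`. -/
noncomputable def jacobian {n : ℕ} (f : (Fin n → ℝ) → (Fin n → ℝ)) (a : Fin n → ℝ) :
    Matrix (Fin n) (Fin n) ℝ :=
  Matrix.of fun i j => fderiv ℝ f a (Pi.single j 1) i

/-- A square matrix is Metzler if its off-diagonal entries are nonnegative. -/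
def IsMetzler {n : ℕ} (A : Matrix (Fin n) (Fin n) ℝ) : Prop :=
  ∀ i j, i ≠ j → 0 ≤ A i j

/-- Cooperativity on `S` of a vector field that is differentiable at the points of `S`:
the Jacobian is Metzler at every point of `S`. -/
def CooperativeOn {n : ℕ} (f : (Fin n → ℝ) → (Fin n → ℝ)) (S : Set (Fin n → ℝ)) : Prop :=
  ∀ a ∈ S, IsMetzler (jacobian f a)

/-- `g` is order-preserving on `S` (for the componentwise order). -/
def OrderPreservingOn {n : ℕ} (g : (Fin n → ℝ) → (Fin n → ℝ)) (S : Set (Fin n → ℝ)) : Prop :=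
  ∀ x ∈ S, ∀ y ∈ S, (∀ i, x i ≤ y i) → ∀ i, g x i ≤ g y i

/-- `f` is sub-homogeneous of degree `α` on the cone `S`. -/
def SubHomogeneousOn {n : ℕ} (f : (Fin n → ℝ) → (Fin n → ℝ)) (α : ℝ)
    (S : Set (Fin n → ℝ)) : Prop :=
  ∀ x ∈ S, ∀ c : ℝ, 1 ≤ c → ∀ i, f (c • x) i ≤ c ^ α * f x i

/-- Heterogeneous time-varying delays, continuous on `[0, ∞)` with values in `[0, τmax]`.
`τ i j t` is the delay of the component `j` in the equation of the component `i`. -/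
structure IsDelay {n : ℕ} (τmax : ℝ) (τ : Fin n → Fin n → ℝ → ℝ) : Prop where
  bound_nonneg : 0 ≤ τmax
  continuousOn : ∀ i j, ContinuousOn (τ i j) (Ici 0)
  nonneg : ∀ i j, ∀ t, 0 ≤ t → 0 ≤ τ i j t
  le_bound : ∀ i j, ∀ t, 0 ≤ t → τ i j t ≤ τmax

/-- The delayed state `(x₁(t - τ i 1 t), …, xₙ(t - τ i n t))` seen by the equation of `xᵢ`. -/
def delayed {n : ℕ} (τ : Fin n → Fin n → ℝ → ℝ) (x : ℝ → (Fin n → ℝ)) (i : Fin n) (t : ℝ) :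
    Fin n → ℝ :=
  fun j => x (t - τ i j t) j

/-- `x` is a solution on `[-τmax, ∞)`, in the domain `W` of the vector fields, of
`xᵢ'(t) = fᵢ(x(t)) + gᵢ(x₁(t - τ i 1 t), …, xₙ(t - τ i n t))` for `t ≥ 0`,
with `x = φ` on `[-τmax, 0]`. The derivative is two-sided for `t > 0` and one-sided at `t = 0`. -/
structure IsSolution {n : ℕ} (W : Set (Fin n → ℝ)) (f g : (Fin n → ℝ) → (Fin n → ℝ))
    (τmax : ℝ) (τ : Fin n → Fin n → ℝ → ℝ) (φ x : ℝ → (Fin n → ℝ)) : Prop where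
  initial : ∀ t ∈ Icc (-τmax) 0, x t = φ t
  mem : ∀ t, -τmax ≤ t → x t ∈ W
  delayed_mem : ∀ t, 0 ≤ t → ∀ i, delayed τ x i t ∈ W
  hasDeriv : ∀ t, 0 ≤ t → ∀ i,
    HasDerivWithinAt (fun s => x s i) (f (x t) i + g (delayed τ x i t) i) (Ici 0) t

/-- Nonnegative initial conditions: continuous functions from `[-τmax, 0]` to `ℝⁿ₊`. -/
def IsInitial {n : ℕ} (τmax : ℝ) (φ : ℝ → (Fin n → ℝ)) : Prop :=
  ContinuousOn φ (Icc (-τmax) 0) ∧ ∀ t ∈ Icc (-τmax) 0, φ t ∈ orthant n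

/-- `xs` is an equilibrium in `ℝⁿ₊` that is globally asymptotically stable with respect to
nonnegative initial conditions: it is Lyapunov stable, every nonnegative initial condition has
a solution on all of `[0, ∞)`, and the solution converges to `xs`. -/
structure IsGAS {n : ℕ} (W : Set (Fin n → ℝ)) (f g : (Fin n → ℝ) → (Fin n → ℝ))
    (τmax : ℝ) (τ : Fin n → Fin n → ℝ → ℝ) (xs : Fin n → ℝ) : Prop where
  mem_orthant : xs ∈ orthant n
  equilibrium : f xs + g xs = 0
  stable : ∀ ε : ℝ, 0 < ε → ∃ δ : ℝ, 0 < δ ∧ ∀ φ x : ℝ → (Fin n → ℝ), IsInitial τmax φ →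
    (∀ t ∈ Icc (-τmax) 0, ‖φ t - xs‖ < δ) → IsSolution W f g τmax τ φ x →
    ∀ t, 0 ≤ t → ‖x t - xs‖ < ε
  exists_solution : ∀ φ : ℝ → (Fin n → ℝ), IsInitial τmax φ →
    ∃ x : ℝ → (Fin n → ℝ), IsSolution W f g τmax τ φ x
  attractive : ∀ φ x : ℝ → (Fin n → ℝ), IsInitial τmax φ → IsSolution W f g τmax τ φ x →
    Tendsto x atTop (𝓝 xs)

end DelaySystem

/-! Put `F = f + g`. The conditions `0 ≤ F v` and `F w ≤ 0` on constant vectors do not involve the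
delays, and by the comparison principle `le_of_comparison` they make the box `[v, w]` invariant for
every choice of delays (`IsSolution.mem_Icc`). It therefore suffices to extract enough such vectors
from stability under one choice of delays. Supersolutions strictly above `xs` and arbitrarily close
to it come from `IsGAS.exists_superequilibrium`: otherwise a near-subsolution would hold a solution
away from `xs`. Sub-homogeneity scales them up to dominate any initial condition, and scaling `xs`
down gives subsolutions below it. The small boxes yield Lyapunov stability, the large ones existence
and boundedness. For attraction, let `s` and `l` be the componentwise upper and lower limits of a
solution. The fluctuation lemmas `nonneg_of_limsup` and `nonpos_of_liminf` give `0 ≤ F s` and `F l ≤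
0`. Quasimonotonicity then yields an equilibrium above `s` and another below `l`. Equilibria are
constant solutions for all delays, so both equal `xs`, and `xs ≤ l ≤ s ≤ xs`. -/

namespace DelaySystem

variable {n : ℕ}

/-! ### Order properties of the fields, first crossings and extremal points -/

/-- `f` is quasimonotone on `S`: `f i` is monotone in all variables but the `i`-th. -/
def QuasimonotoneOn (f : (Fin n → ℝ) → (Fin n → ℝ)) (S : Set (Fin n → ℝ)) : Prop :=
  ∀ x ∈ S, ∀ y ∈ S, x ≤ y → ∀ i, x i = y i → f x i ≤ f y i

/-- The filter argument also covers `n = 0`, where `c` has no minimum. -/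
theorem exists_pos_forall_le (c : Fin n → ℝ) (hc : ∀ i, 0 < c i) :
    ∃ δ : ℝ, 0 < δ ∧ ∀ i, δ ≤ c i := by
  have h : ∀ᶠ δ in 𝓝[>] (0 : ℝ), ∀ i, δ ≤ c i :=
    eventually_all.2 fun i => ((eventually_lt_nhds (hc i)).filter_mono nhdsWithin_le_nhds).mono
      fun _ h => h.le
  obtain ⟨δ, h1, h2⟩ := (h.and self_mem_nhdsWithin).exists
  exact ⟨δ, h2, h1⟩

/-- Along the segment from `x` to `y`, the derivative of `f i` is `∑ j, ∂ⱼfᵢ * (y j - x j)`. The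
diagonal term vanishes because `x i = y i`; the others are nonnegative. -/
theorem CooperativeOn.quasimonotoneOn {f : (Fin n → ℝ) → (Fin n → ℝ)} {W : Set (Fin n → ℝ)}
    (hWo : IsOpen W) (hW : orthant n ⊆ W) (hf : ContDiffOn ℝ 1 f W)
    (hfc : CooperativeOn f (orthant n)) : QuasimonotoneOn f (orthant n) := by
  intro x hx y hy hxy i hi
  set γ : ℝ → (Fin n → ℝ) := fun s => x + s • (y - x) with hγ
  have hγm : ∀ s ∈ Icc (0 : ℝ) 1, γ s ∈ orthant n := by
    intro s hs j
    have h1 := hx j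
    have h2 := hxy j
    have h3 := mul_nonneg hs.1 (sub_nonneg.2 h2)
    simp only [hγ, Pi.add_apply, Pi.smul_apply, Pi.sub_apply, smul_eq_mul]
    linarith
  have hd : ∀ s ∈ Icc (0 : ℝ) 1,
      HasDerivAt (fun s => f (γ s) i) (fderiv ℝ f (γ s) (y - x) i) s := by
    intro s hs
    have hfd : HasFDerivAt f (fderiv ℝ f (γ s)) (γ s) :=
      ((hf.differentiableOn one_ne_zero).differentiableAt
        (hWo.mem_nhds (hW (hγm s hs)))).hasFDerivAt
    have hγd : HasDerivAt γ (y - x) s := by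
      simpa [hγ] using ((hasDerivAt_id s).smul_const (y - x)).const_add x
    exact hasDerivAt_pi.1 (hfd.comp_hasDerivAt s hγd) i
  have hmono : MonotoneOn (fun s => f (γ s) i) (Icc 0 1) := by
    refine monotoneOn_of_deriv_nonneg (convex_Icc _ _)
      (fun s hs => (hd s hs).continuousAt.continuousWithinAt)
      (fun s hs => (hd s (interior_subset hs)).differentiableAt.differentiableWithinAt) ?_
    intro s hs
    have hs := interior_subset hs
    rw [(hd s hs).deriv]
    have hsum : y - x = ∑ j, (y j - x j) • (Pi.single j 1 : Fin n → ℝ) := by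
      ext k
      simp [Finset.sum_apply, Pi.single_apply]
    rw [hsum, map_sum, Finset.sum_apply]
    refine Finset.sum_nonneg fun j _ => ?_
    rw [map_smul, Pi.smul_apply, smul_eq_mul]
    rcases eq_or_ne i j with rfl | hij
    · simp [hi]
    · exact mul_nonneg (sub_nonneg.2 (hxy j)) (hfc _ (hγm s hs) i j hij)
  have := hmono (left_mem_Icc.2 zero_le_one) (right_mem_Icc.2 zero_le_one) zero_le_one
  simpa [hγ] using this

/-- Scaling fixes the origin, so `f 0 ≤ 2 ^ α * f 0` with `2 ^ α > 1`. This makes `0` a subsolution.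
-/
theorem SubHomogeneousOn.zero_nonneg {f : (Fin n → ℝ) → (Fin n → ℝ)} {α : ℝ} (hα : 0 < α)
    (hf : SubHomogeneousOn f α (orthant n)) : 0 ≤ f 0 := by
  intro i
  have h := hf 0 (fun _ => le_rfl) 2 one_le_two i
  rw [smul_zero] at h
  have h2 : (1 : ℝ) < 2 ^ α := Real.one_lt_rpow one_lt_two hα
  have : 0 ≤ (2 ^ α - 1) * f 0 i := by linarith
  exact nonneg_of_mul_nonneg_right this (by linarith)

/-- `f` is Lipschitz on `K` with constant `L`, for the supremum norm, in coordinates. -/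
def LipschitzBoundOn (f : (Fin n → ℝ) → (Fin n → ℝ)) (L : ℝ) (K : Set (Fin n → ℝ)) : Prop :=
  ∀ x ∈ K, ∀ y ∈ K, ∀ η : ℝ, 0 ≤ η → (∀ j, |x j - y j| ≤ η) → ∀ i, |f x i - f y i| ≤ L * η

theorem exists_lipschitzBoundOn {f : (Fin n → ℝ) → (Fin n → ℝ)} {W K : Set (Fin n → ℝ)}
    (hWc : Convex ℝ W) (hf : ContDiffOn ℝ 1 f W) (hK : IsCompact K) (hKW : K ⊆ W) :
    ∃ L : ℝ, 0 ≤ L ∧ LipschitzBoundOn f L K := by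
  obtain ⟨L, hL⟩ := ((hf.locallyLipschitzOn hWc).mono hKW).exists_lipschitzOnWith_of_compact hK
  refine ⟨L, L.2, fun x hx y hy η h0 hη i => ?_⟩
  have h1 : dist (f x) (f y) ≤ L * dist x y := hL.dist_le_mul x hx y hy
  have h2 : dist x y ≤ η := (dist_pi_le_iff h0).2 fun j => by simpa [Real.dist_eq] using hη j
  have h3 := dist_le_pi_dist (f x) (f y) i
  rw [Real.dist_eq] at h3
  exact h3.trans (h1.trans (mul_le_mul_of_nonneg_left h2 L.2))

/-- First-crossing principle: a function that starts nonnegative and that does not decrease too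
fast at the first time at which a component reaches a negative level stays nonnegative. -/
theorem nonneg_of_barrier {a T C : ℝ} {u u' : ℝ → (Fin n → ℝ)}
    (h0 : ∀ t ∈ Icc a 0, ∀ i, 0 ≤ u t i) (ha : a ≤ 0)
    (hd : ∀ t ∈ Icc 0 T, ∀ i, HasDerivWithinAt (fun s => u s i) (u' t i) (Ici 0) t)
    (hb : ∀ t ∈ Icc 0 T, ∀ i, ∀ η : ℝ, 0 < η → (∀ s ∈ Icc a t, ∀ j, -η ≤ u s j) →
      u t i = -η → -C * η ≤ u' t i) :
    ∀ t ∈ Icc 0 T, ∀ i, 0 ≤ u t i := by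
  intro t₁ ht₁ i₁
  by_contra! hneg
  -- The barrier `-ε * exp (D * t)` falls strictly faster than `u` is allowed to at a touching
  -- point, since `D > C`; `ε` is small enough for the barrier to be reached by time `t₁`.
  set D : ℝ := |C| + 1 with hD
  have hDC : C < D := by linarith [le_abs_self C]
  have hDp : 0 < D := by positivity
  obtain ⟨ε, hε, hε1⟩ : ∃ ε : ℝ, 0 < ε ∧ u t₁ i₁ + ε * Real.exp (D * t₁) ≤ 0 := by
    refine ⟨-u t₁ i₁ / Real.exp (D * t₁), div_pos (by linarith) (Real.exp_pos _), ?_⟩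
    rw [div_mul_cancel₀ _ (Real.exp_pos _).ne']
    linarith
  set h : ℝ → Fin n → ℝ := fun t i => u t i + ε * Real.exp (D * t) with hh
  have hcont : ∀ i, ContinuousOn (fun t => h t i) (Icc 0 T) := by
    intro i t ht
    refine ContinuousWithinAt.add
      ((hd t ht i).continuousWithinAt.mono Icc_subset_Ici_self) ?_
    exact (by fun_prop : Continuous fun t => ε * Real.exp (D * t)).continuousWithinAt
  set A : Set ℝ := ⋃ i, {t ∈ Icc 0 T | h t i ≤ 0} with hA
  have hAc : IsCompact A := by
    refine isCompact_iUnion fun i => ?_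
    exact isCompact_Icc.of_isClosed_subset
      ((hcont i).preimage_isClosed_of_isClosed isClosed_Icc isClosed_Iic) fun t ht => ht.1
  obtain ⟨t₀, ht₀, hmin⟩ := hAc.exists_isLeast ⟨t₁, mem_iUnion.2 ⟨i₁, ht₁, hε1⟩⟩
  obtain ⟨i, htT, hle⟩ := mem_iUnion.1 ht₀
  have hbefore : ∀ s, 0 ≤ s → s < t₀ → ∀ j, 0 < h s j := by
    intro s hs hst j
    by_contra! hcon
    exact absurd (hmin (mem_iUnion.2 ⟨j, ⟨hs, hst.le.trans htT.2⟩, hcon⟩)) (not_le.2 hst)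
  have ht₀p : 0 < t₀ := by
    rcases htT.1.eq_or_lt with h1 | h1
    · exfalso
      rw [← h1] at hle
      have := h0 0 ⟨ha, le_rfl⟩ i
      simp only [hh, mul_zero, Real.exp_zero, mul_one] at hle
      linarith
    · exact h1
  have hnb : (𝓝[Ioo 0 t₀] t₀).NeBot := by
    rw [← mem_closure_iff_nhdsWithin_neBot, closure_Ioo ht₀p.ne]
    exact right_mem_Icc.2 ht₀p.le
  have hge : ∀ j, 0 ≤ h t₀ j := by
    intro j
    have hc : Tendsto (fun t => h t j) (𝓝[Ioo 0 t₀] t₀) (𝓝 (h t₀ j)) :=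
      (hcont j t₀ htT).mono_left
        (nhdsWithin_mono _ fun s hs => ⟨hs.1.le, hs.2.le.trans htT.2⟩)
    refine ge_of_tendsto hc ?_
    filter_upwards [self_mem_nhdsWithin] with s hs using (hbefore s hs.1.le hs.2 j).le
  have heq : h t₀ i = 0 := le_antisymm hle (hge i)
  set η : ℝ := ε * Real.exp (D * t₀) with hη
  have hηp : 0 < η := by positivity
  have hu := hb t₀ htT i η hηp (by
    intro s hs j
    rcases le_or_gt s 0 with h1 | h1
    · linarith [h0 s ⟨hs.1, h1⟩ j]
    · have h2 : 0 ≤ h s j := by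
        rcases hs.2.eq_or_lt with rfl | h3
        · exact hge j
        · exact (hbefore s h1.le h3 j).le
      have h4 : ε * Real.exp (D * s) ≤ η := by
        rw [hη]
        gcongr
        exact hs.2
      simp only [hh] at h2
      linarith) (by simp only [hh] at heq; linarith)
  have hder : HasDerivWithinAt (fun t => h t i) (u' t₀ i + ε * (Real.exp (D * t₀) * D))
      (Ioo 0 t₀) t₀ := by
    have h1 : HasDerivAt (fun t : ℝ => ε * Real.exp (D * t)) (ε * (Real.exp (D * t₀) * D)) t₀ := by
      have := ((hasDerivAt_id t₀).const_mul D).exp.const_mul ε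
      simpa using this
    exact ((hd t₀ htT i).mono fun s hs => hs.1.le).add h1.hasDerivWithinAt
  have hslope := (hasDerivWithinAt_iff_tendsto_slope' (by simp)).1 hder
  -- `h` is positive before `t₀` and zero at `t₀`, so its left derivative is nonpositive: `u' ≤ -D *
  -- η`, against `u' ≥ -C * η`.
  have hnonpos : u' t₀ i + ε * (Real.exp (D * t₀) * D) ≤ 0 := by
    refine le_of_tendsto hslope ?_
    filter_upwards [self_mem_nhdsWithin] with s hs
    rw [slope_def_field, heq, sub_zero]
    exact div_nonpos_of_nonneg_of_nonpos (hbefore s hs.1.le hs.2 i).le (by linarith [hs.2])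
  have : ε * (Real.exp (D * t₀) * D) = D * η := by rw [hη]; ring
  nlinarith

/-- A maximal point of the box `[q, p]` at which a quasimonotone field is at least `-ε`. -/
theorem exists_maximal_subequilibrium {F : (Fin n → ℝ) → (Fin n → ℝ)}
    (hFc : ContinuousOn F (orthant n)) (hFq : QuasimonotoneOn F (orthant n))
    {p q : Fin n → ℝ} {ε : ℝ} (hq0 : 0 ≤ q) (hqp : q ≤ p) (hq : ∀ i, -ε ≤ F q i) :
    ∃ w, q ≤ w ∧ w ≤ p ∧ (∀ i, -ε ≤ F w i) ∧ ∀ i, w i < p i → F w i = -ε := by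
  set S : Set (Fin n → ℝ) := {z ∈ Icc q p | ∀ i, -ε ≤ F z i} with hS
  have hbox : Icc q p ⊆ orthant n := fun z hz => hq0.trans hz.1
  have hSc : IsCompact S := by
    have : S = Icc q p ∩ ⋂ i, {z ∈ Icc q p | -ε ≤ F z i} := by
      ext z
      simp only [hS, mem_ofPred_eq, mem_inter_iff, mem_iInter]
      exact ⟨fun h => ⟨h.1, fun i => ⟨h.1, h.2 i⟩⟩, fun h => ⟨h.1, fun i => (h.2 i).2⟩⟩
    rw [this]
    refine isCompact_Icc.inter_right (isClosed_iInter fun i => ?_)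
    exact ((continuousOn_pi.1 (hFc.mono hbox)) i).preimage_isClosed_of_isClosed isClosed_Icc
      isClosed_Ici
  -- Maximising the coordinate sum forbids raising any coordinate. If `w i < p i` and `F w i > -ε`,
  -- coordinate `i` could be raised slightly: component `i` of `F` stays above `-ε` by continuity,
  -- the others do not decrease by quasimonotonicity.
  obtain ⟨w, hw, hmax⟩ := hSc.exists_isMaxOn ⟨q, ⟨le_rfl, hqp⟩, hq⟩
    (f := fun z : Fin n → ℝ => ∑ i, z i) (by fun_prop)
  refine ⟨w, hw.1.1, hw.1.2, hw.2, fun i hi => ?_⟩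
  have hw0 : 0 ≤ w := hq0.trans hw.1.1
  refine le_antisymm ?_ (hw.2 i)
  by_contra! hcon
  set γ : ℝ → (Fin n → ℝ) := fun h => w + h • Pi.single i 1 with hγ
  have hγ0 : γ 0 = w := by simp [hγ]
  have hwγ : ∀ h, 0 ≤ h → w ≤ γ h := fun h hh => by
    refine le_add_of_nonneg_right (smul_nonneg hh ?_)
    exact Pi.single_nonneg.2 zero_le_one
  have hγi : ∀ h, γ h i = w i + h := fun h => by simp [hγ]
  have hγj : ∀ h j, j ≠ i → γ h j = w j := fun h j hj => by simp [hγ, hj]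
  have hcont : Tendsto (fun h => F (γ h) i) (𝓝[>] 0) (𝓝 (F w i)) := by
    have h1 : ContinuousWithinAt (fun h => F (γ h) i) (Ioi 0) 0 := by
      refine ((continuousOn_pi.1 hFc) i).continuousWithinAt (x := γ 0) ?_ |>.comp
        (by fun_prop) ?_
      · rw [hγ0]; exact hw0
      · intro h hh
        exact hw0.trans (hwγ h (le_of_lt hh))
    have := h1.tendsto
    rwa [hγ0] at this
  obtain ⟨h, ⟨h1, h2⟩, h3⟩ := ((hcont.eventually (lt_mem_nhds hcon)).and
    ((eventually_lt_nhds (sub_pos.2 hi)).filter_mono nhdsWithin_le_nhds)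
    |>.and self_mem_nhdsWithin).exists
  have h3 : 0 < h := h3
  have hmem : γ h ∈ S := by
    refine ⟨⟨hw.1.1.trans (hwγ h h3.le), fun j => ?_⟩, fun j => ?_⟩
    · rcases eq_or_ne j i with rfl | hj
      · rw [hγi]; linarith
      · rw [hγj h j hj]; exact hw.1.2 j
    · rcases eq_or_ne j i with rfl | hj
      · exact h1.le
      · exact (hw.2 j).trans (hFq w hw0 _ (hw0.trans (hwγ h h3.le)) (hwγ h h3.le) j
          (hγj h j hj).symm)
  have : ∑ i, w i < ∑ i, (γ h) i :=
    Finset.sum_lt_sum (fun j _ => hwγ h h3.le j) ⟨i, Finset.mem_univ i, by rw [hγi]; linarith⟩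
  exact absurd (hmax hmem) (not_le.2 this)

/-- A minimal point of the box `[0, q]` at which a quasimonotone field is nonpositive. -/
theorem exists_minimal_superequilibrium {F : (Fin n → ℝ) → (Fin n → ℝ)}
    (hFc : ContinuousOn F (orthant n)) (hFq : QuasimonotoneOn F (orthant n))
    {q : Fin n → ℝ} (hq0 : 0 ≤ q) (hq : F q ≤ 0) :
    ∃ w, 0 ≤ w ∧ F w ≤ 0 ∧ w ≤ q ∧ ∀ i, 0 < w i → F w i = 0 := by
  set S : Set (Fin n → ℝ) := {z ∈ Icc 0 q | ∀ i, F z i ≤ 0} with hS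
  have hbox : Icc 0 q ⊆ orthant n := fun z hz => hz.1
  have hSc : IsCompact S := by
    have : S = Icc 0 q ∩ ⋂ i, {z ∈ Icc 0 q | F z i ≤ 0} := by
      ext z
      simp only [hS, mem_ofPred_eq, mem_inter_iff, mem_iInter]
      exact ⟨fun h => ⟨h.1, fun i => ⟨h.1, h.2 i⟩⟩, fun h => ⟨h.1, fun i => (h.2 i).2⟩⟩
    rw [this]
    refine isCompact_Icc.inter_right (isClosed_iInter fun i => ?_)
    exact ((continuousOn_pi.1 (hFc.mono hbox)) i).preimage_isClosed_of_isClosed isClosed_Icc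
      isClosed_Iic
  obtain ⟨w, hw, hmin⟩ := hSc.exists_isMinOn ⟨q, ⟨hq0, le_rfl⟩, hq⟩
    (f := fun z : Fin n → ℝ => ∑ i, z i) (by fun_prop)
  refine ⟨w, hw.1.1, hw.2, hw.1.2, fun i hi => ?_⟩
  refine le_antisymm (hw.2 i) ?_
  by_contra! hcon
  set γ : ℝ → (Fin n → ℝ) := fun h => w - h • Pi.single i 1 with hγ
  have hγ0 : γ 0 = w := by simp [hγ]
  have hwγ : ∀ h, 0 ≤ h → γ h ≤ w := fun h hh => by
    refine sub_le_self _ (smul_nonneg hh ?_)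
    exact Pi.single_nonneg.2 zero_le_one
  have hγi : ∀ h, γ h i = w i - h := fun h => by simp [hγ]
  have hγj : ∀ h j, j ≠ i → γ h j = w j := fun h j hj => by simp [hγ, hj]
  have hγn : ∀ h, h ≤ w i → 0 ≤ γ h := fun h hh j => by
    rcases eq_or_ne j i with rfl | hj
    · rw [hγi]; simpa using hh
    · rw [hγj h j hj]; exact hw.1.1 j
  -- The step is kept below `w i` because continuity of `F` is known only on the orthant.
  have hcont : Tendsto (fun h => F (γ h) i) (𝓝[Ioo 0 (w i)] 0) (𝓝 (F w i)) := by
    have h1 : ContinuousWithinAt (fun h => F (γ h) i) (Ioo 0 (w i)) 0 := by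
      refine ((continuousOn_pi.1 hFc) i).continuousWithinAt (x := γ 0) ?_ |>.comp
        (by fun_prop) ?_
      · rw [hγ0]; exact hw.1.1
      · intro h hh
        exact hγn h hh.2.le
    have := h1.tendsto
    rwa [hγ0] at this
  have hnb : (𝓝[Ioo 0 (w i)] (0 : ℝ)).NeBot := by
    rw [← mem_closure_iff_nhdsWithin_neBot, closure_Ioo hi.ne]
    exact left_mem_Icc.2 hi.le
  obtain ⟨h, h1, h3⟩ := ((hcont.eventually (gt_mem_nhds hcon)).and self_mem_nhdsWithin).exists
  have hmem : γ h ∈ S := by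
    refine ⟨⟨hγn h h3.2.le, (hwγ h h3.1.le).trans hw.1.2⟩, fun j => ?_⟩
    rcases eq_or_ne j i with rfl | hj
    · exact h1.le
    · exact (hFq _ (hγn h h3.2.le) w hw.1.1 (hwγ h h3.1.le) j (hγj h j hj)).trans (hw.2 j)
  have : ∑ i, (γ h) i < ∑ i, w i :=
    Finset.sum_lt_sum (fun j _ => hwγ h h3.1.le j)
      ⟨i, Finset.mem_univ i, by rw [hγi]; linarith [h3.1]⟩
  exact absurd (hmin hmem) (not_le.2 this)

end DelaySystem

/-! ### Comparison principle, positivity and invariant boxes -/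

namespace DelaySystem

variable {n : ℕ}

theorem QuasimonotoneOn.nonneg_of_eq_zero {f : (Fin n → ℝ) → (Fin n → ℝ)}
    (hf : QuasimonotoneOn f (orthant n)) (hf0 : 0 ≤ f 0) {x : Fin n → ℝ} (hx : 0 ≤ x) {i : Fin n}
    (hi : x i = 0) : 0 ≤ f x i :=
  (hf0 i).trans (hf 0 (fun _ => le_rfl) x hx hx i hi.symm)

theorem OrderPreservingOn.nonneg {g : (Fin n → ℝ) → (Fin n → ℝ)}
    (hg : OrderPreservingOn g (orthant n)) (hg0 : 0 ≤ g 0) {x : Fin n → ℝ} (hx : 0 ≤ x) :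
    0 ≤ g x :=
  fun i => (hg0 i).trans (hg 0 (fun _ => le_rfl) x hx hx i)

theorem OrderPreservingOn.quasimonotoneOn {g : (Fin n → ℝ) → (Fin n → ℝ)} {S : Set (Fin n → ℝ)}
    (hg : OrderPreservingOn g S) : QuasimonotoneOn g S :=
  fun x hx y hy hxy i _ => hg x hx y hy hxy i

theorem QuasimonotoneOn.add {f g : (Fin n → ℝ) → (Fin n → ℝ)} {S : Set (Fin n → ℝ)}
    (hf : QuasimonotoneOn f S) (hg : QuasimonotoneOn g S) : QuasimonotoneOn (f + g) S :=
  fun x hx y hy hxy i hi => add_le_add (hf x hx y hy hxy i hi) (hg x hx y hy hxy i hi)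

theorem LipschitzBoundOn.of_le {f : (Fin n → ℝ) → (Fin n → ℝ)} {K : Set (Fin n → ℝ)} {L L' : ℝ}
    (hf : LipschitzBoundOn f L K) (h : L ≤ L') : LipschitzBoundOn f L' K :=
  fun x hx y hy η hη hj i => (hf x hx y hy η hη hj i).trans (mul_le_mul_of_nonneg_right h hη)

section

variable {τmax : ℝ} {τ : Fin n → Fin n → ℝ → ℝ}

theorem IsDelay.sub_mem (hτ : IsDelay τmax τ) (i j : Fin n) {t : ℝ} (ht : 0 ≤ t) :
    t - τ i j t ∈ Icc (-τmax) t :=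
  ⟨by linarith [hτ.le_bound i j t ht], by linarith [hτ.nonneg i j t ht]⟩

theorem IsDelay.delayed_mem_Icc (hτ : IsDelay τmax τ) {x : ℝ → (Fin n → ℝ)} {a b : Fin n → ℝ}
    {t : ℝ} (ht : 0 ≤ t) (hx : ∀ s ∈ Icc (-τmax) t, x s ∈ Icc a b) (i : Fin n) :
    delayed τ x i t ∈ Icc a b :=
  ⟨fun j => (hx _ (hτ.sub_mem i j ht)).1 j, fun j => (hx _ (hτ.sub_mem i j ht)).2 j⟩

theorem IsDelay.delayed_nonneg (hτ : IsDelay τmax τ) {x : ℝ → (Fin n → ℝ)}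
    {t : ℝ} (ht : 0 ≤ t) (hx : ∀ s ∈ Icc (-τmax) t, 0 ≤ x s) (i : Fin n) :
    0 ≤ delayed τ x i t :=
  fun j => hx _ (hτ.sub_mem i j ht) j

/-- Comparison principle for the delay system. -/
theorem le_of_comparison {f g : (Fin n → ℝ) → (Fin n → ℝ)} {R : Fin n → ℝ} {T L : ℝ}
    (hf : QuasimonotoneOn f (orthant n)) (hg : OrderPreservingOn g (orthant n))
    (hfL : LipschitzBoundOn f L (Icc 0 R)) (hgL : LipschitzBoundOn g L (Icc 0 R))
    (hτ : IsDelay τmax τ) {x y x' y' : ℝ → (Fin n → ℝ)}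
    (hx : ∀ t ∈ Icc (-τmax) T, x t ∈ Icc 0 R) (hy : ∀ t ∈ Icc (-τmax) T, 0 ≤ y t)
    (hxd : ∀ t ∈ Icc 0 T, ∀ i, HasDerivWithinAt (fun s => x s i) (x' t i) (Ici 0) t)
    (hyd : ∀ t ∈ Icc 0 T, ∀ i, HasDerivWithinAt (fun s => y s i) (y' t i) (Ici 0) t)
    (hxy : ∀ t ∈ Icc 0 T, ∀ i, x' t i - y' t i ≤
      (f (x t) i + g (delayed τ x i t) i) - (f (y t) i + g (delayed τ y i t) i))
    (h0 : ∀ t ∈ Icc (-τmax) 0, x t ≤ y t) :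
    ∀ t ∈ Icc 0 T, x t ≤ y t := by
  have key := nonneg_of_barrier (a := -τmax) (T := T) (C := 2 * L) (u := fun t => y t - x t)
    (u' := fun t => y' t - x' t) (fun t ht i => sub_nonneg.2 (h0 t ht i))
    (neg_nonpos.2 hτ.bound_nonneg) (fun t ht i => (hyd t ht i).sub (hxd t ht i)) ?_
  · exact fun t ht i => sub_nonneg.1 (key t ht i)
  intro t ht i η hη hall heq
  simp only [Pi.sub_apply] at hall heq ⊢
  have hIcc : Icc (-τmax) t ⊆ Icc (-τmax) T := Icc_subset_Icc_right ht.2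
  -- lowering a point of the box by `η`, but not below zero, stays in the box
  have lower : ∀ z : Fin n → ℝ, z ∈ Icc 0 R → (fun j => max (z j - η) 0) ∈ Icc 0 R ∧
      ∀ j, |max (z j - η) 0 - z j| ≤ η := by
    intro z hz
    refine ⟨⟨fun j => le_max_right _ _, fun j => max_le ?_ ((hz.1 j).trans (hz.2 j))⟩, fun j => ?_⟩
    · linarith [hz.2 j]
    · rw [abs_le]
      have h1 : 0 ≤ z j := hz.1 j
      exact ⟨by linarith [le_max_left (z j - η) 0],
        by linarith [max_le (by linarith : z j - η ≤ z j) h1]⟩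
  have htm : t ∈ Icc (-τmax) T := ⟨by linarith [hτ.bound_nonneg, ht.1], ht.2⟩
  have hxt := hx t htm
  have hyt := hy t htm
  have hdx := hτ.delayed_mem_Icc ht.1 (fun s hs => hx s (hIcc hs)) i
  have hdy := hτ.delayed_nonneg ht.1 (fun s hs => hy s (hIcc hs)) i
  -- At touching, `y t i = x t i - η`: the lowered `x t` lies below `y t` and agrees with it in
  -- component `i`, so quasimonotonicity applies. Lowering costs `L * η`, once for `f` and once for
  -- `g`, hence `C = 2 * L`.
  have hF : f (x t) i - L * η ≤ f (y t) i := by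
    obtain ⟨h1, h2⟩ := lower _ hxt
    have h3 := hfL _ h1 _ hxt η hη.le h2 i
    have h4 := hf _ h1.1 (y t) hyt (fun j => max_le (by linarith [hall t ⟨htm.1, le_rfl⟩ j])
      (hyt j)) i (by
        have : 0 ≤ y t i := hyt i
        rw [max_eq_left] <;> linarith)
    linarith [(abs_le.1 h3).1]
  have hG : g (delayed τ x i t) i - L * η ≤ g (delayed τ y i t) i := by
    obtain ⟨h1, h2⟩ := lower _ hdx
    have h3 := hgL _ h1 _ hdx η hη.le h2 i
    have h4 := hg _ h1.1 _ hdy (fun j => max_le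
      (by simp only [delayed]; linarith [hall _ (hτ.sub_mem i j ht.1) j]) (hdy j)) i
    linarith [(abs_le.1 h3).1]
  linarith [hxy t ht i]

variable {W : Set (Fin n → ℝ)} {f g : (Fin n → ℝ) → (Fin n → ℝ)} {φ x : ℝ → (Fin n → ℝ)}

theorem IsSolution.continuousOn (hφ : IsInitial τmax φ) (hx : IsSolution W f g τmax τ φ x) :
    ContinuousOn x (Ici (-τmax)) := by
  have h1 : ContinuousOn x (Icc (-τmax) 0) := hφ.1.congr hx.initial
  have h2 : ContinuousOn x (Ici 0) :=
    continuousOn_pi.2 fun i t ht => (hx.hasDeriv t ht i).continuousWithinAt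
  refine (h1.union_of_isClosed h2 isClosed_Icc isClosed_Ici).mono fun t ht => ?_
  rcases le_total t 0 with h | h
  · exact Or.inl ⟨ht, h⟩
  · exact Or.inr h

theorem IsSolution.exists_le (hφ : IsInitial τmax φ) (hx : IsSolution W f g τmax τ φ x) (T : ℝ) :
    ∃ R : ℝ, ∀ t ∈ Icc (-τmax) T, ∀ i, x t i ≤ R := by
  obtain ⟨R, hR⟩ := (isCompact_Icc.image_of_continuousOn
    ((hx.continuousOn hφ).mono fun t ht => ht.1)).isBounded.exists_norm_le
  exact ⟨R, fun t ht i => (le_abs_self _).trans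
    ((norm_le_pi_norm (x t) i).trans (hR _ (mem_image_of_mem _ ht)))⟩

theorem IsSolution.continuousOn_delayed (hτ : IsDelay τmax τ) (hφ : IsInitial τmax φ)
    (hx : IsSolution W f g τmax τ φ x) (i : Fin n) :
    ContinuousOn (delayed τ x i) (Ici 0) := by
  refine continuousOn_pi.2 fun j => ?_
  refine ((continuousOn_pi.1 (hx.continuousOn hφ)) j).comp
    (continuousOn_id.sub (hτ.continuousOn i j)) fun t ht => (hτ.sub_mem i j ht).1

/-- Nonnegative initial conditions have nonnegative solutions. -/
theorem IsSolution.nonneg (hWc : Convex ℝ W) (hW : orthant n ⊆ W)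
    (hf : ContDiffOn ℝ 1 f W) (hg : ContDiffOn ℝ 1 g W)
    (hfq : QuasimonotoneOn f (orthant n)) (hgo : OrderPreservingOn g (orthant n))
    (hf0 : 0 ≤ f 0) (hg0 : 0 ≤ g 0)
    (hτ : IsDelay τmax τ) (hφ : IsInitial τmax φ) (hx : IsSolution W f g τmax τ φ x) :
    ∀ t, -τmax ≤ t → 0 ≤ x t := by
  have hinit : ∀ t ∈ Icc (-τmax) 0, ∀ i, 0 ≤ x t i := fun t ht i => by
    rw [hx.initial t ht]; exact hφ.2 t ht i
  intro T hT
  rcases le_total T 0 with h | hT0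
  · exact hinit T ⟨hT, h⟩
  set K₀ : Set (Fin n → ℝ) := x '' Icc 0 T ∪ ⋃ i, delayed τ x i '' Icc 0 T with hK₀
  have hK₀c : IsCompact K₀ := by
    refine (isCompact_Icc.image_of_continuousOn ((hx.continuousOn hφ).mono fun t ht => ?_)).union
      (isCompact_iUnion fun i => isCompact_Icc.image_of_continuousOn
        ((hx.continuousOn_delayed hτ hφ i).mono Icc_subset_Ici_self))
    exact (neg_nonpos.2 hτ.bound_nonneg).trans ht.1
  have hK₀W : K₀ ⊆ W := by
    rintro z (⟨t, ht, rfl⟩ | hz)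
    · exact hx.mem t ((neg_nonpos.2 hτ.bound_nonneg).trans ht.1)
    · obtain ⟨i, t, ht, rfl⟩ := mem_iUnion.1 hz
      exact hx.delayed_mem t ht.1 i
  -- A priori the solution lies only in `W`, while the order hypotheses hold on the orthant. The
  -- signs are read off at positive parts and carried back by a Lipschitz bound on a compact set
  -- containing both.
  set K : Set (Fin n → ℝ) := K₀ ∪ (fun z => z ⊔ 0) '' K₀ with hK
  have hKc : IsCompact K := hK₀c.union (hK₀c.image (continuous_pi
    fun j => (continuous_apply j).max continuous_const))
  have hKW : K ⊆ W := by
    rintro z (hz | ⟨z, hz, rfl⟩)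
    · exact hK₀W hz
    · exact hW fun i => le_max_right _ _
  obtain ⟨L₁, -, hL₁⟩ := exists_lipschitzBoundOn hWc hf hKc hKW
  obtain ⟨L₂, -, hL₂⟩ := exists_lipschitzBoundOn hWc hg hKc hKW
  have pos : ∀ (z : Fin n → ℝ) (η : ℝ), 0 < η → (∀ j, -η ≤ z j) →
      ∀ j, |z j - (z ⊔ 0) j| ≤ η := by
    intro z η hη hz j
    rw [abs_le, Pi.sup_apply, Pi.zero_apply]
    rcases le_total (z j) 0 with h | h
    · rw [sup_of_le_right h]; exact ⟨by linarith [hz j], by linarith⟩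
    · rw [sup_of_le_left h]; exact ⟨by linarith [hz j], by linarith⟩
  refine nonneg_of_barrier (a := -τmax) (T := T) (C := L₁ + L₂) (u := x)
    (u' := fun t i => f (x t) i + g (delayed τ x i t) i) hinit
    (neg_nonpos.2 hτ.bound_nonneg) (fun t ht i => hx.hasDeriv t ht.1 i) ?_ T ⟨hT0, le_rfl⟩
  intro t ht i η hη hall heq
  have hz₁ : x t ∈ K₀ := Or.inl ⟨t, ht, rfl⟩
  have hz₂ : delayed τ x i t ∈ K₀ := Or.inr (mem_iUnion.2 ⟨i, t, ht, rfl⟩)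
  have h1 := hL₁ _ (Or.inl hz₁) _ (Or.inr ⟨_, hz₁, rfl⟩) η hη.le
    (pos _ η hη (hall t ⟨(neg_nonpos.2 hτ.bound_nonneg).trans ht.1, le_rfl⟩)) i
  have h2 := hL₂ _ (Or.inl hz₂) _ (Or.inr ⟨_, hz₂, rfl⟩) η hη.le
    (pos _ η hη fun j => hall _ (hτ.sub_mem i j ht.1) j) i
  have h3 : 0 ≤ f (x t ⊔ 0) i := hfq.nonneg_of_eq_zero hf0 le_sup_right
    (by rw [Pi.sup_apply, heq, Pi.zero_apply]; exact sup_of_le_right (by linarith))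
  have h4 : 0 ≤ g (delayed τ x i t ⊔ 0) i := hgo.nonneg hg0 le_sup_right i
  have h5 := (abs_le.1 h1).1
  have h6 := (abs_le.1 h2).1
  simp only at h5 h6
  linarith

/-- A box bounded by a constant subsolution and a constant supersolution is invariant. -/
theorem IsSolution.mem_Icc (hWc : Convex ℝ W) (hW : orthant n ⊆ W)
    (hf : ContDiffOn ℝ 1 f W) (hg : ContDiffOn ℝ 1 g W)
    (hfq : QuasimonotoneOn f (orthant n)) (hgo : OrderPreservingOn g (orthant n))
    (hf0 : 0 ≤ f 0) (hg0 : 0 ≤ g 0)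
    (hτ : IsDelay τmax τ) (hφ : IsInitial τmax φ) (hx : IsSolution W f g τmax τ φ x)
    {v w : Fin n → ℝ} (hv : 0 ≤ v) (hw : 0 ≤ w) (hFv : 0 ≤ (f + g) v) (hFw : (f + g) w ≤ 0)
    (hφvw : ∀ t ∈ Icc (-τmax) 0, φ t ∈ Icc v w) :
    ∀ t, -τmax ≤ t → x t ∈ Icc v w := by
  have hinit : ∀ t ∈ Icc (-τmax) 0, x t ∈ Icc v w := fun t ht => by
    rw [hx.initial t ht]; exact hφvw t ht
  have hnn := hx.nonneg hWc hW hf hg hfq hgo hf0 hg0 hτ hφ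
  intro T hT
  rcases le_total T 0 with h | hT0
  · exact hinit T ⟨hT, h⟩
  obtain ⟨R, hR⟩ := hx.exists_le hφ T
  -- The comparison needs a bound on the lower function only: `v` in one use, `x` in the other.
  set R' : Fin n → ℝ := (fun _ => R) ⊔ v with hR'
  have hbox : Icc 0 R' ⊆ W := fun z hz => hW hz.1
  obtain ⟨L₁, hL₁0, hL₁⟩ := exists_lipschitzBoundOn hWc hf isCompact_Icc hbox
  obtain ⟨L₂, hL₂0, hL₂⟩ := exists_lipschitzBoundOn hWc hg isCompact_Icc hbox
  have h1 := hL₁.of_le (by linarith : L₁ ≤ L₁ + L₂)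
  have h2 := hL₂.of_le (by linarith : L₂ ≤ L₁ + L₂)
  have hconst : ∀ (c : Fin n → ℝ), ∀ t ∈ Icc 0 T, ∀ i,
      HasDerivWithinAt (fun _ : ℝ => c i) ((fun (_ : ℝ) (_ : Fin n) => (0 : ℝ)) t i) (Ici 0) t :=
    fun c t _ i => hasDerivWithinAt_const _ _ _
  have hdel : ∀ (c : Fin n → ℝ) i t, delayed τ (fun _ => c) i t = c := fun c i t => rfl
  have hxd : ∀ t ∈ Icc 0 T, ∀ i, HasDerivWithinAt (fun s => x s i)
      ((fun t i => f (x t) i + g (delayed τ x i t) i) t i) (Ici 0) t :=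
    fun t ht i => hx.hasDeriv t ht.1 i
  constructor
  · refine le_of_comparison (x := fun _ => v) hfq hgo h1 h2 hτ (fun t _ => ⟨hv, le_sup_right⟩)
      (fun t ht => hnn t ht.1) (hconst v) hxd (fun t ht i => ?_) (fun t ht => (hinit t ht).1)
      T ⟨hT0, le_rfl⟩
    have : 0 ≤ f v i + g v i := hFv i
    rw [hdel]
    linarith
  · refine le_of_comparison (y := fun _ => w) hfq hgo h1 h2 hτ
      (fun t ht => ⟨hnn t ht.1, le_sup_of_le_left (hR t ht)⟩)
      (fun t ht => hw) hxd (hconst w) (fun t ht i => ?_) (fun t ht => (hinit t ht).2)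
      T ⟨hT0, le_rfl⟩
    have : f w i + g w i ≤ 0 := hFw i
    rw [hdel]
    linarith

end

end DelaySystem

/-! ### Global existence -/

namespace DelaySystem

variable {n : ℕ} {τmax : ℝ} {τ : Fin n → Fin n → ℝ → ℝ}

/-- Global existence for the delay equation with bounded, globally Lipschitz right-hand sides. -/
theorem exists_solution_of_lipschitz {f g : (Fin n → ℝ) → (Fin n → ℝ)} {L M : ℝ} (hL : 0 ≤ L)
    (hfL : LipschitzBoundOn f L univ) (hgL : LipschitzBoundOn g L univ)
    (hfM : ∀ x i, |f x i| ≤ M) (hgM : ∀ x i, |g x i| ≤ M)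
    (hτ : IsDelay τmax τ) {φ : ℝ → (Fin n → ℝ)} (hφ : ContinuousOn φ (Icc (-τmax) 0)) :
    ∃ x : ℝ → (Fin n → ℝ), (∀ t ∈ Icc (-τmax) 0, x t = φ t) ∧ ∀ t, 0 ≤ t → ∀ i,
      HasDerivWithinAt (fun s => x s i) (f (x t) i + g (delayed τ x i t) i) (Ici 0) t := by
  have hτ0 : -τmax ≤ 0 := neg_nonpos.2 hτ.bound_nonneg
  set ψ : ℝ → (Fin n → ℝ) := IccExtend hτ0 ((Icc (-τmax) 0).domRestrict φ) with hψ
  have hψc : Continuous ψ := (continuousOn_iff_continuous_domRestrict.1 hφ).Icc_extend'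
  set σ : Fin n → Fin n → ℝ → ℝ := fun i j t => τ i j (max t 0) with hσ
  have hσc : ∀ i j, Continuous (σ i j) := fun i j =>
    (hτ.continuousOn i j).comp_continuous (by fun_prop) fun t => mem_Ici.2 (le_max_right _ _)
  have hσ0 : ∀ i j t, 0 ≤ σ i j t := fun i j t => hτ.nonneg i j _ (le_max_right _ _)
  have cont : ∀ h : (Fin n → ℝ) → (Fin n → ℝ), LipschitzBoundOn h L univ → Continuous h := by
    intro h hh
    refine (LipschitzWith.of_dist_le_mul (K := ⟨L, hL⟩) fun x y => ?_).continuous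
    refine (dist_pi_le_iff (by positivity)).2 fun i => ?_
    rw [Real.dist_eq]
    exact hh x trivial y trivial _ dist_nonneg (fun j => dist_le_pi_dist x y j) i
  have hfc := cont f hfL
  have hgc := cont g hgL
  -- In the norm weighted by `exp (-K * t)` the Picard map has Lipschitz constant `2 * L / K ≤ 1 /
  -- 2`. Delays do no harm, since the weight at `t - σ` is controlled by the one at `t`.
  set K : ℝ := 4 * L + 1 with hK
  have hKp : 0 < K := by positivity
  rcases isEmpty_or_nonempty (Fin n) with hn | hn
  · exact ⟨φ, fun _ _ => rfl, fun t _ i => isEmptyElim i⟩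
  have hM : 0 ≤ M := (abs_nonneg _).trans (hfM 0 (Classical.arbitrary _))
  -- solutions are sought in the form `ψ + exp (K t) z`, with `z` bounded
  set X : (BoundedContinuousFunction ℝ (Fin n → ℝ)) → ℝ → (Fin n → ℝ) :=
    fun z t => ψ t + Real.exp (K * t) • z t with hX
  have hXc : ∀ z, Continuous (X z) := fun z => by
    have := z.continuous
    simp only [hX]
    fun_prop
  set H : (BoundedContinuousFunction ℝ (Fin n → ℝ)) → ℝ → (Fin n → ℝ) :=
    fun z t i => f (X z t) i + g (fun j => X z (t - σ i j t) j) i with hH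
  have hHc : ∀ z, Continuous (H z) := by
    intro z
    refine continuous_pi fun i => ?_
    refine ((continuous_apply i).comp (hfc.comp (hXc z))).add
      ((continuous_apply i).comp (hgc.comp (continuous_pi fun j => ?_)))
    exact (continuous_apply j).comp ((hXc z).comp (continuous_id.sub (hσc i j)))
  have hHM : ∀ z t, ‖H z t‖ ≤ 2 * M := fun z t => by
    refine (pi_norm_le_iff_of_nonneg (by positivity)).2 fun i => ?_
    refine (abs_add_le _ _).trans ?_
    linarith [hfM (X z t) i, hgM (fun j => X z (t - σ i j t) j) i]
  have hHL : ∀ z z' t, ‖H z t - H z' t‖ ≤ 2 * L * dist z z' * Real.exp (K * t) := by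
    intro z z' t
    have hXX : ∀ s, s ≤ t → ∀ j, |X z s j - X z' s j| ≤ Real.exp (K * t) * dist z z' := by
      intro s hs j
      have h1 : X z s j - X z' s j = Real.exp (K * s) * (z s j - z' s j) := by
        simp only [hX, Pi.add_apply, Pi.smul_apply, smul_eq_mul]; ring
      rw [h1, abs_mul, abs_of_pos (Real.exp_pos _)]
      have h2 : |z s j - z' s j| ≤ dist z z' :=
        (dist_le_pi_dist (z s) (z' s) j).trans (BoundedContinuousFunction.dist_coe_le_dist s)
      have h3 : Real.exp (K * s) ≤ Real.exp (K * t) := by gcongr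
      gcongr
    refine (pi_norm_le_iff_of_nonneg (by positivity)).2 fun i => ?_
    have hη : 0 ≤ Real.exp (K * t) * dist z z' := by positivity
    have h1 := hfL (X z t) trivial (X z' t) trivial _ hη (hXX t le_rfl) i
    have h2 := hgL (fun j => X z (t - σ i j t) j) trivial (fun j => X z' (t - σ i j t) j) trivial
      _ hη (fun j => hXX _ (by linarith [hσ0 i j t]) j) i
    have h3 : (H z t - H z' t) i = (f (X z t) i - f (X z' t) i) +
        (g (fun j => X z (t - σ i j t) j) i - g (fun j => X z' (t - σ i j t) j) i) := by
      simp only [hH, Pi.sub_apply]; ring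
    rw [h3]
    refine (abs_add_le _ _).trans ?_
    linarith
  -- The upper limit `max t 0` makes the correction vanish for `t ≤ 0`, so a fixed point keeps the
  -- initial data.
  set Φ : (BoundedContinuousFunction ℝ (Fin n → ℝ)) → ℝ → (Fin n → ℝ) :=
    fun z t => Real.exp (-(K * t)) • ∫ s in (0 : ℝ)..max t 0, H z s with hΦ
  have hΦc : ∀ z, Continuous (Φ z) := by
    intro z
    have h1 : Continuous fun u : ℝ => ∫ s in (0 : ℝ)..u, H z s :=
      intervalIntegral.continuous_primitive (fun a b => (hHc z).intervalIntegrable a b) 0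
    exact (by fun_prop : Continuous fun t => Real.exp (-(K * t))).smul
      (h1.comp (by fun_prop : Continuous fun t : ℝ => max t 0))
  have hΦ0 : ∀ z t, t ≤ 0 → Φ z t = 0 := fun z t ht => by
    simp only [hΦ, max_eq_right ht, intervalIntegral.integral_same, smul_zero]
  have hΦM : ∀ z t, ‖Φ z t‖ ≤ 2 * M / K := by
    intro z t
    rcases le_total t 0 with ht | ht
    · rw [hΦ0 z t ht, norm_zero]; positivity
    · simp only [hΦ, max_eq_left ht]
      rw [norm_smul, Real.norm_of_nonneg (Real.exp_pos _).le]
      have h1 : ‖∫ s in (0 : ℝ)..t, H z s‖ ≤ 2 * M * |t - 0| :=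
        intervalIntegral.norm_integral_le_of_norm_le_const fun s _ => hHM z s
      rw [sub_zero, abs_of_nonneg ht] at h1
      have h2 : K * t ≤ Real.exp (K * t) := by linarith [Real.add_one_le_exp (K * t)]
      calc Real.exp (-(K * t)) * ‖∫ s in (0 : ℝ)..t, H z s‖
          ≤ Real.exp (-(K * t)) * (2 * M * t) := by gcongr
        _ = Real.exp (-(K * t)) * (K * t) * (2 * M / K) := by field_simp
        _ ≤ Real.exp (-(K * t)) * Real.exp (K * t) * (2 * M / K) := by gcongr
        _ = 2 * M / K := by rw [← Real.exp_add]; simp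
  set Ψ : (BoundedContinuousFunction ℝ (Fin n → ℝ)) → (BoundedContinuousFunction ℝ (Fin n → ℝ)) :=
    fun z => BoundedContinuousFunction.ofNormedAddCommGroup (Φ z) (hΦc z) _ (hΦM z) with hΨ
  have hcontr : ContractingWith (1 / 2) Ψ := by
    refine ⟨by rw [← NNReal.coe_lt_coe]; norm_num, LipschitzWith.of_dist_le_mul fun z z' => ?_⟩
    refine (BoundedContinuousFunction.dist_le (by positivity)).2 fun t => ?_
    change dist (Φ z t) (Φ z' t) ≤ _
    rcases le_total t 0 with ht | ht
    · rw [hΦ0 z t ht, hΦ0 z' t ht, dist_self]; positivity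
    · rw [dist_eq_norm]
      simp only [hΦ, max_eq_left ht]
      rw [← smul_sub, norm_smul, Real.norm_of_nonneg (Real.exp_pos _).le,
        ← intervalIntegral.integral_sub ((hHc z).intervalIntegrable _ _)
          ((hHc z').intervalIntegrable _ _)]
      have h1 : ∫ s in (0 : ℝ)..t, 2 * L * dist z z' * Real.exp (K * s) =
          2 * L * dist z z' * (Real.exp (K * t) / K) - 2 * L * dist z z' * (Real.exp (K * 0) / K) := by
        refine intervalIntegral.integral_eq_sub_of_hasDerivAt (fun s _ => ?_)
          (Continuous.intervalIntegrable (by fun_prop) _ _)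
          (f := fun s => 2 * L * dist z z' * (Real.exp (K * s) / K))
        have h := ((((hasDerivAt_id s).const_mul K).exp.div_const K).const_mul
          (2 * L * dist z z'))
        refine h.congr_deriv ?_
        simp only [id, mul_one]
        field_simp
      have h2 : ‖∫ s in (0 : ℝ)..t, (H z s - H z' s)‖ ≤
          ∫ s in (0 : ℝ)..t, 2 * L * dist z z' * Real.exp (K * s) :=
        intervalIntegral.norm_integral_le_of_norm_le ht
          (Filter.Eventually.of_forall fun s _ => hHL z z' s)
          (Continuous.intervalIntegrable (by fun_prop) _ _)
      have h3 : ‖∫ s in (0 : ℝ)..t, (H z s - H z' s)‖ ≤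
          2 * L * dist z z' * (Real.exp (K * t) / K) := by
        rw [h1] at h2
        have : 0 ≤ 2 * L * dist z z' * (Real.exp (K * 0) / K) := by positivity
        linarith
      calc Real.exp (-(K * t)) * ‖∫ s in (0 : ℝ)..t, (H z s - H z' s)‖
          ≤ Real.exp (-(K * t)) * (2 * L * dist z z' * (Real.exp (K * t) / K)) := by gcongr
        _ = Real.exp (-(K * t)) * Real.exp (K * t) * (2 * L / K * dist z z') := by field_simp
        _ = 2 * L / K * dist z z' := by rw [← Real.exp_add]; simp
        _ ≤ 1 / 2 * dist z z' := by
          refine mul_le_mul_of_nonneg_right ?_ dist_nonneg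
          rw [div_le_div_iff₀ hKp two_pos]
          linarith
  set z := hcontr.fixedPoint Ψ with hz
  have hfix : ∀ t, Φ z t = z t := fun t =>
    congrArg (fun y : BoundedContinuousFunction ℝ (Fin n → ℝ) => y t) hcontr.fixedPoint_isFixedPt
  have hXint : ∀ t, 0 ≤ t → X z t = ψ 0 + ∫ s in (0 : ℝ)..t, H z s := by
    intro t ht
    have h1 : ψ t = ψ 0 := by
      simp only [hψ]
      rw [IccExtend_of_right_le _ _ ht, IccExtend_of_right_le _ _ le_rfl]
    simp only [hX]
    rw [← hfix t, h1]
    simp only [hΦ, max_eq_left ht]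
    rw [smul_smul, ← Real.exp_add]
    simp
  refine ⟨X z, fun t ht => ?_, fun t ht i => ?_⟩
  · simp only [hX]
    rw [← hfix t, hΦ0 z t ht.2, smul_zero, add_zero]
    simp only [hψ]
    rw [IccExtend_of_mem _ _ ht]
    rfl
  · have h1 : H z t i = f (X z t) i + g (delayed τ (X z) i t) i := by
      simp only [hH, hσ, max_eq_left ht]
      rfl
    rw [← h1]
    have h2 : HasDerivAt (fun u => ψ 0 + ∫ s in (0 : ℝ)..u, H z s) (H z t) t :=
      ((hHc z).integral_hasStrictDerivAt 0 t).hasDerivAt.const_add _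
    exact ((hasDerivAt_pi.1 h2 i).hasDerivWithinAt).congr (fun s hs => by rw [hXint s hs])
      (by rw [hXint t ht])

/-- Existence of solutions below a constant supersolution. -/
theorem exists_isSolution_of_superequilibrium {W : Set (Fin n → ℝ)}
    {f g : (Fin n → ℝ) → (Fin n → ℝ)} (hWc : Convex ℝ W) (hW : orthant n ⊆ W)
    (hf : ContDiffOn ℝ 1 f W) (hg : ContDiffOn ℝ 1 g W)
    (hfq : QuasimonotoneOn f (orthant n)) (hgo : OrderPreservingOn g (orthant n))
    (hf0 : 0 ≤ f 0) (hg0 : 0 ≤ g 0) (hτ : IsDelay τmax τ) {φ : ℝ → (Fin n → ℝ)}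
    (hφ : IsInitial τmax φ) {w : Fin n → ℝ} (hw : 0 ≤ w) (hFw : (f + g) w ≤ 0)
    (hφw : ∀ t ∈ Icc (-τmax) 0, φ t ≤ w) :
    ∃ x : ℝ → (Fin n → ℝ), IsSolution W f g τmax τ φ x := by
  -- Clipping to `[0, w]` makes the fields bounded and globally Lipschitz. At a crossing of a face
  -- the clipped coordinate lies exactly on that face, so the barrier applies with `C = 0`.
  -- Solutions stay in the box, where `P` is the identity.
  set P : (Fin n → ℝ) → (Fin n → ℝ) := fun x j => max 0 (min (x j) (w j)) with hP
  have hPm : ∀ x, P x ∈ Icc 0 w := fun x =>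
    ⟨fun j => le_max_left _ _, fun j => max_le (hw j) (min_le_right _ _)⟩
  have hPL : ∀ x y j, |P x j - P y j| ≤ |x j - y j| := by
    intro x y j
    simp only [hP]
    have h1 := abs_max_sub_max_le_max 0 (min (x j) (w j)) 0 (min (y j) (w j))
    have h2 := abs_min_sub_min_le_max (x j) (w j) (y j) (w j)
    simp only [sub_self, abs_zero, abs_nonneg, sup_of_le_right, sup_of_le_left] at h1 h2
    exact h1.trans h2
  have hPid : ∀ x, x ∈ Icc 0 w → P x = x := fun x hx => by
    ext j
    simp only [hP]
    rw [min_eq_left (hx.2 j)]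
    exact max_eq_right (hx.1 j)
  have hbox : Icc 0 w ⊆ W := fun z hz => hW hz.1
  obtain ⟨L₁, hL₁0, hL₁⟩ := exists_lipschitzBoundOn hWc hf isCompact_Icc hbox
  obtain ⟨L₂, hL₂0, hL₂⟩ := exists_lipschitzBoundOn hWc hg isCompact_Icc hbox
  have hbd : ∀ h : (Fin n → ℝ) → (Fin n → ℝ), ContDiffOn ℝ 1 h W →
      ∃ M, ∀ x i, |h (P x) i| ≤ M := by
    intro h hh
    obtain ⟨M, hM⟩ := (isCompact_Icc.image_of_continuousOn
      (hh.continuousOn.mono hbox)).isBounded.exists_norm_le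
    exact ⟨M, fun x i => (norm_le_pi_norm (h (P x)) i).trans (hM _ (mem_image_of_mem _ (hPm x)))⟩
  obtain ⟨M₁, hM₁⟩ := hbd f hf
  obtain ⟨M₂, hM₂⟩ := hbd g hg
  have hcomp : ∀ (h : (Fin n → ℝ) → (Fin n → ℝ)) L, LipschitzBoundOn h L (Icc 0 w) →
      LipschitzBoundOn (fun x => h (P x)) L univ := fun h L hh x _ y _ η hη hj i =>
    hh _ (hPm x) _ (hPm y) η hη (fun j => (hPL x y j).trans (hj j)) i
  obtain ⟨x, hx0, hxd⟩ := exists_solution_of_lipschitz (f := fun x => f (P x))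
    (g := fun x => g (P x)) (add_nonneg hL₁0 hL₂0)
    (hcomp f _ (hL₁.of_le (by linarith))) (hcomp g _ (hL₂.of_le (by linarith)))
    (fun x i => (hM₁ x i).trans (le_max_left M₁ M₂))
    (fun x i => (hM₂ x i).trans (le_max_right M₁ M₂)) hτ hφ.1
  have hlow : ∀ T, 0 ≤ T → 0 ≤ x T := fun T hT => by
    refine nonneg_of_barrier (a := -τmax) (T := T) (C := 0)
      (fun t ht i => by rw [hx0 t ht]; exact hφ.2 t ht i) (neg_nonpos.2 hτ.bound_nonneg)
      (fun t ht i => hxd t ht.1 i) ?_ T ⟨hT, le_rfl⟩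
    intro t ht i η hη _ heq
    have h1 : 0 ≤ f (P (x t)) i := hfq.nonneg_of_eq_zero hf0 (hPm _).1 (by
      simp only [hP]
      exact max_eq_left ((min_le_left _ _).trans (by linarith)))
    have h2 : 0 ≤ g (P (delayed τ x i t)) i := hgo.nonneg hg0 (hPm _).1 i
    linarith
  have hup : ∀ T, 0 ≤ T → x T ≤ w := fun T hT i => by
    have := nonneg_of_barrier (a := -τmax) (T := T) (C := 0) (u := fun t i => w i - x t i)
      (fun t ht i => by rw [hx0 t ht]; exact sub_nonneg.2 (hφw t ht i))
      (neg_nonpos.2 hτ.bound_nonneg) (fun t ht i => (hxd t ht.1 i).const_sub (w i)) ?_ T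
      ⟨hT, le_rfl⟩ i
    · exact sub_nonneg.1 this
    intro t ht i η hη _ heq
    have h1 : f (P (x t)) i ≤ f w i := hfq _ (hPm _).1 _ hw (hPm _).2 i (by
      simp only [hP]
      have : 0 ≤ w i := hw i
      rw [min_eq_right (by linarith), max_eq_right this])
    have h2 : g (P (delayed τ x i t)) i ≤ g w i := hgo _ (hPm _).1 _ hw (hPm _).2 i
    have h3 : f w i + g w i ≤ 0 := hFw i
    linarith
  have hmem : ∀ t, -τmax ≤ t → x t ∈ Icc 0 w := fun t ht => by
    rcases le_total t 0 with h | h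
    · rw [hx0 t ⟨ht, h⟩]; exact ⟨hφ.2 t ⟨ht, h⟩, hφw t ⟨ht, h⟩⟩
    · exact ⟨hlow t h, hup t h⟩
  have hdel : ∀ t, 0 ≤ t → ∀ i, delayed τ x i t ∈ Icc 0 w := fun t ht i =>
    hτ.delayed_mem_Icc ht (fun s hs => hmem s hs.1) i
  refine ⟨x, hx0, fun t ht => hbox (hmem t ht), fun t ht i => hbox (hdel t ht i),
    fun t ht i => ?_⟩
  have := hxd t ht i
  rwa [hPid _ (hmem t ((neg_nonpos.2 hτ.bound_nonneg).trans ht)), hPid _ (hdel t ht i)] at this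

/-! ### Fluctuation principle -/

/-- A real function that decreases at a uniform rate while above `c` is eventually at most `c`. -/
theorem eventually_le_of_deriv_le {u u' : ℝ → ℝ} {c η t₀ : ℝ} (hη : 0 < η) (ht₀ : 0 ≤ t₀)
    (hd : ∀ t, 0 ≤ t → HasDerivWithinAt u (u' t) (Ici 0) t)
    (h : ∀ t, t₀ ≤ t → c ≤ u t → u' t ≤ -η) : ∀ᶠ t in atTop, u t ≤ c := by
  have hcont : ContinuousOn u (Ici 0) := fun t ht => (hd t ht).continuousWithinAt
  obtain ⟨t₁, ht₁, hu₁⟩ : ∃ t₁, t₀ ≤ t₁ ∧ u t₁ ≤ c := by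
    by_contra! hcon
    set T : ℝ := t₀ + (u t₀ - c) / η with hT
    have hTt : t₀ ≤ T := by
      have := div_nonneg (sub_nonneg.2 (hcon t₀ le_rfl).le) hη.le
      linarith
    have := image_le_of_deriv_right_le_deriv_boundary (f := u) (f' := u') (a := t₀) (b := T)
      (B := fun t => u t₀ - η * (t - t₀)) (B' := fun _ => -η)
      (hcont.mono fun t ht => ht₀.trans ht.1)
      (fun t ht => (hd t (ht₀.trans ht.1)).mono fun s hs => (ht₀.trans ht.1).trans hs)
      (by simp) (by fun_prop)
      (fun t _ => by
        have h1 := (((hasDerivAt_id t).sub_const t₀).const_mul η).const_sub (u t₀)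
        simpa using h1.hasDerivWithinAt)
      (fun t ht => h t ht.1 (hcon t ht.1).le) ⟨hTt, le_rfl⟩
    have h2 : η * (T - t₀) = u t₀ - c := by rw [hT]; field_simp; ring
    simp only [h2] at this
    linarith [hcon T hTt]
  -- Once at or below `c`, the function cannot cross upward, its derivative at level `c` being
  -- negative.
  filter_upwards [eventually_ge_atTop t₁] with t ht
  exact image_le_of_deriv_right_lt_deriv_boundary (f := u) (f' := u') (a := t₁) (b := t)
    (B := fun _ => c) (B' := fun _ => 0) (hcont.mono fun s hs => (ht₀.trans ht₁).trans hs.1)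
    (fun s hs => (hd s ((ht₀.trans ht₁).trans hs.1)).mono fun r hr =>
      ((ht₀.trans ht₁).trans hs.1).trans hr)
    hu₁ (fun s => hasDerivAt_const s c)
    (fun s hs hs' => (h s (ht₁.trans hs.1) hs'.ge).trans_lt (neg_lt_zero.2 hη)) ⟨ht, le_rfl⟩

end DelaySystem

namespace DelaySystem

variable {n : ℕ} {τmax : ℝ} {τ : Fin n → Fin n → ℝ → ℝ} {W : Set (Fin n → ℝ)}
  {f g : (Fin n → ℝ) → (Fin n → ℝ)} {α : ℝ} {xs : Fin n → ℝ}

/-- Separate points for `f` and `g` are needed because `f` sees the current state and `g` the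
delayed one. -/
theorem exists_pos_abs_add_sub_lt (hfc : ContinuousOn f (orthant n))
    (hgc : ContinuousOn g (orthant n)) {s : Fin n → ℝ} (hs : 0 ≤ s) (i : Fin n) {κ : ℝ}
    (hκ : 0 < κ) :
    ∃ ρ : ℝ, 0 < ρ ∧ ∀ z z' : Fin n → ℝ, 0 ≤ z → 0 ≤ z' → (∀ j, |z j - s j| ≤ ρ) →
      (∀ j, |z' j - s j| ≤ ρ) → |f z i + g z' i - (f + g) s i| < κ := by
  have key : ∀ h : (Fin n → ℝ) → (Fin n → ℝ), ContinuousOn h (orthant n) → ∃ ρ : ℝ, 0 < ρ ∧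
      ∀ z : Fin n → ℝ, 0 ≤ z → (∀ j, |z j - s j| ≤ ρ) → |h z i - h s i| < κ / 2 := by
    intro h hh
    obtain ⟨δ, hδ, hd⟩ := Metric.continuousWithinAt_iff.1
      ((continuousOn_pi.1 hh i) s hs) (κ / 2) (half_pos hκ)
    refine ⟨δ / 2, half_pos hδ, fun z hz hzs => hd hz ?_⟩
    exact ((dist_pi_le_iff (half_pos hδ).le).2 hzs).trans_lt (half_lt_self hδ)
  obtain ⟨ρ₁, hρ₁, h₁⟩ := key f hfc
  obtain ⟨ρ₂, hρ₂, h₂⟩ := key g hgc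
  refine ⟨min ρ₁ ρ₂, lt_min hρ₁ hρ₂, fun z z' hz hz' hzs hzs' => ?_⟩
  have h3 := h₁ z hz fun j => (hzs j).trans (min_le_left _ _)
  have h4 := h₂ z' hz' fun j => (hzs' j).trans (min_le_right _ _)
  rw [abs_lt] at h3 h4 ⊢
  simp only [Pi.add_apply]
  constructor <;> linarith

/-- Fluctuation principle: the vector field is nonnegative at the componentwise upper limit of a
nonnegative solution. -/
theorem nonneg_of_limsup (hfc : ContinuousOn f (orthant n)) (hgc : ContinuousOn g (orthant n))
    (hfq : QuasimonotoneOn f (orthant n)) (hgo : OrderPreservingOn g (orthant n))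
    (hτ : IsDelay τmax τ) {x : ℝ → (Fin n → ℝ)} (hx : ∀ t, -τmax ≤ t → 0 ≤ x t)
    (hd : ∀ t, 0 ≤ t → ∀ i,
      HasDerivWithinAt (fun s => x s i) (f (x t) i + g (delayed τ x i t) i) (Ici 0) t)
    {s : Fin n → ℝ} (hs : 0 ≤ s) (hev : ∀ ρ > 0, ∀ j, ∀ᶠ t in atTop, x t j < s j + ρ)
    (hfr : ∀ ρ > 0, ∀ j, ∃ᶠ t in atTop, s j - ρ < x t j) : 0 ≤ (f + g) s := by
  intro i
  by_contra! hneg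
  rw [Pi.zero_apply] at hneg
  obtain ⟨ρ, hρ, hclose⟩ := exists_pos_abs_add_sub_lt hfc hgc hs i
    (half_pos (neg_pos.2 hneg))
  obtain ⟨t₀, ht₀⟩ := eventually_atTop.1 (eventually_all.2 (hev ρ hρ))
  have hτ0 := hτ.bound_nonneg
  -- While `x t i` is within `ρ` of `s i`, its derivative is uniformly negative, so it ends up below
  -- `s i - ρ`, contradicting the upper limit. The shift by `τmax` puts the delayed times past `t₀`
  -- as well.
  have hle := eventually_le_of_deriv_le (u := fun t => x t i)
    (u' := fun t => f (x t) i + g (delayed τ x i t) i) (c := s i - ρ)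
    (t₀ := max t₀ 0 + τmax) (half_pos (neg_pos.2 hneg))
    (add_nonneg (le_max_right _ _) hτ0) (fun t ht => hd t ht i) ?_
  · exact hfr ρ hρ i (hle.mono fun t ht => not_lt.2 ht)
  intro t ht hxt
  have ht0 : 0 ≤ t := (add_nonneg (le_max_right t₀ 0) hτ0).trans ht
  have htt : ∀ r, t - τmax ≤ r → ∀ j, x r j < s j + ρ := fun r hr j =>
    ht₀ r (by linarith [le_max_left t₀ 0]) j
  have hxp := hx t (by linarith)
  have hdp := hτ.delayed_nonneg ht0 (fun r hr => hx r hr.1) i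
  set z' : Fin n → ℝ := fun j => s j + ρ with hz'
  -- Quasimonotonicity of `f` requires agreement with `x t` in component `i`; `g` can be bounded at
  -- `z'` itself.
  set z : Fin n → ℝ := Function.update z' i (x t i) with hz
  have hz'p : 0 ≤ z' := fun j => by
    have : 0 ≤ s j := hs j
    simp only [hz', Pi.zero_apply]; linarith
  have hzj : ∀ j, x t j ≤ z j ∧ 0 ≤ z j ∧ |z j - s j| ≤ ρ := by
    intro j
    have h1 := htt t (by linarith) j
    rcases eq_or_ne j i with rfl | hj
    · simp only [hz, Function.update_self]
      exact ⟨le_rfl, hxp j, abs_le.2 ⟨by linarith, by linarith⟩⟩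
    · simp only [hz, Function.update_of_ne hj]
      exact ⟨h1.le, hz'p j, by simp [hz', abs_of_pos hρ]⟩
  have h1 : f (x t) i ≤ f z i := hfq _ hxp z (fun j => (hzj j).2.1) (fun j => (hzj j).1) i
    (by simp [hz])
  have h2 : g (delayed τ x i t) i ≤ g z' i := hgo _ hdp z' hz'p
    (fun j => (htt _ (by linarith [hτ.le_bound i j t ht0]) j).le) i
  have h3 := (abs_lt.1 (hclose z z' (fun j => (hzj j).2.1) hz'p (fun j => (hzj j).2.2)
    (fun j => by simp [hz', abs_of_pos hρ]))).2
  linarith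

/-- Fluctuation principle: the vector field is nonpositive at the componentwise lower limit of a
nonnegative solution. -/
theorem nonpos_of_liminf (hfc : ContinuousOn f (orthant n)) (hgc : ContinuousOn g (orthant n))
    (hfq : QuasimonotoneOn f (orthant n)) (hgo : OrderPreservingOn g (orthant n))
    (hτ : IsDelay τmax τ) {x : ℝ → (Fin n → ℝ)} (hx : ∀ t, -τmax ≤ t → 0 ≤ x t)
    (hd : ∀ t, 0 ≤ t → ∀ i,
      HasDerivWithinAt (fun s => x s i) (f (x t) i + g (delayed τ x i t) i) (Ici 0) t)
    {s : Fin n → ℝ} (hs : 0 ≤ s) (hev : ∀ ρ > 0, ∀ j, ∀ᶠ t in atTop, s j - ρ < x t j)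
    (hfr : ∀ ρ > 0, ∀ j, ∃ᶠ t in atTop, x t j < s j + ρ) : (f + g) s ≤ 0 := by
  intro i
  by_contra! hpos
  rw [Pi.zero_apply] at hpos
  obtain ⟨ρ, hρ, hclose⟩ := exists_pos_abs_add_sub_lt hfc hgc hs i (half_pos hpos)
  obtain ⟨t₀, ht₀⟩ := eventually_atTop.1 (eventually_all.2 (hev ρ hρ))
  have hτ0 := hτ.bound_nonneg
  have hle := eventually_le_of_deriv_le (u := fun t => -x t i)
    (u' := fun t => -(f (x t) i + g (delayed τ x i t) i)) (c := -(s i + ρ))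
    (t₀ := max t₀ 0 + τmax) (half_pos hpos)
    (add_nonneg (le_max_right _ _) hτ0) (fun t ht => (hd t ht i).neg) ?_
  · exact hfr ρ hρ i (hle.mono fun t ht => not_lt.2 (neg_le_neg_iff.1 ht))
  intro t ht hxt
  have hxt := neg_le_neg_iff.1 hxt
  have ht0 : 0 ≤ t := (add_nonneg (le_max_right t₀ 0) hτ0).trans ht
  have htt : ∀ r, t - τmax ≤ r → ∀ j, s j - ρ < x r j := fun r hr j =>
    ht₀ r (by linarith [le_max_left t₀ 0]) j
  have hxp := hx t (by linarith)
  have hdp := hτ.delayed_nonneg ht0 (fun r hr => hx r hr.1) i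
  set z' : Fin n → ℝ := fun j => max (s j - ρ) 0 with hz'
  set z : Fin n → ℝ := Function.update z' i (x t i) with hz
  have hz'p : 0 ≤ z' := fun j => le_max_right _ _
  have hz's : ∀ j, |z' j - s j| ≤ ρ := fun j => by
    have : 0 ≤ s j := hs j
    exact abs_le.2 ⟨by linarith [le_max_left (s j - ρ) 0],
      by linarith [max_le (by linarith : s j - ρ ≤ s j) this]⟩
  have hzj : ∀ j, z j ≤ x t j ∧ 0 ≤ z j ∧ |z j - s j| ≤ ρ := by
    intro j
    have h1 := htt t (by linarith) j
    rcases eq_or_ne j i with rfl | hj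
    · simp only [hz, Function.update_self]
      exact ⟨le_rfl, hxp j, abs_le.2 ⟨by linarith, by linarith⟩⟩
    · simp only [hz, Function.update_of_ne hj]
      exact ⟨max_le h1.le (hxp j), hz'p j, hz's j⟩
  have h1 : f z i ≤ f (x t) i := hfq z (fun j => (hzj j).2.1) _ hxp (fun j => (hzj j).1) i
    (by simp [hz])
  have h2 : g z' i ≤ g (delayed τ x i t) i := hgo z' hz'p _ hdp
    (fun j => max_le (htt _ (by linarith [hτ.le_bound i j t ht0]) j).le (hdp j)) i
  have h3 := (abs_lt.1 (hclose z z' (fun j => (hzj j).2.1) hz'p (fun j => (hzj j).2.2) hz's)).1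
  linarith

/-! ### From stability for one delay to stability for all -/

theorem isSolution_const (hW : orthant n ⊆ W) {z : Fin n → ℝ} (hz : 0 ≤ z)
    (hF : (f + g) z = 0) : IsSolution W f g τmax τ (fun _ => z) (fun _ => z) where
  initial _ _ := rfl
  mem _ _ := hW hz
  delayed_mem _ _ _ := hW hz
  hasDeriv t _ i := by
    have : f z i + g (delayed τ (fun _ => z) i t) i = 0 := congrFun hF i
    rw [this]
    exact hasDerivWithinAt_const _ _ _

theorem IsGAS.eq_of_equilibrium (h : IsGAS W f g τmax τ xs) (hW : orthant n ⊆ W)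
    {z : Fin n → ℝ} (hz : 0 ≤ z) (hF : (f + g) z = 0) : z = xs :=
  tendsto_nhds_unique tendsto_const_nhds
    (h.attractive (fun _ => z) _ ⟨continuousOn_const, fun _ _ => hz⟩ (isSolution_const hW hz hF))

/-- Arbitrarily close to a globally asymptotically stable equilibrium of the delay system there
are constant supersolutions that are strictly greater in every component. -/
theorem IsGAS.exists_superequilibrium (h : IsGAS W f g τmax τ xs) (hWc : Convex ℝ W)
    (hW : orthant n ⊆ W) (hf : ContDiffOn ℝ 1 f W) (hg : ContDiffOn ℝ 1 g W)
    (hfq : QuasimonotoneOn f (orthant n)) (hgo : OrderPreservingOn g (orthant n))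
    (hf0 : 0 ≤ f 0) (hg0 : 0 ≤ g 0) (hτ : IsDelay τmax τ) {d : ℝ} (hd : 0 < d) :
    ∃ w : Fin n → ℝ, (∀ i, xs i < w i) ∧ (∀ i, w i ≤ xs i + d) ∧ (f + g) w ≤ 0 := by
  have hxs : 0 ≤ xs := h.mem_orthant
  have hFxs : (f + g) xs = 0 := h.equilibrium
  set p : Fin n → ℝ := fun i => xs i + d with hp
  have hxp : xs ≤ p := fun i => by simp only [hp]; linarith
  have hφ : IsInitial τmax (fun _ => p) := ⟨continuousOn_const, fun _ _ => hxs.trans hxp⟩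
  obtain ⟨y, hy⟩ := h.exists_solution (fun _ => p) hφ
  obtain ⟨T, hTd, hT⟩ := (((Metric.tendsto_nhds.1 (h.attractive _ y hφ hy)) (d / 4)
    (by positivity)).and (eventually_ge_atTop 0)).exists
  have hyT : ∀ i, y T i ≤ xs i + d / 4 := fun i => by
    have := ((dist_le_pi_dist (y T) xs i).trans_lt hTd).le
    rw [Real.dist_eq] at this
    linarith [(abs_le.1 this).2]
  have hyn := hy.nonneg hWc hW hf hg hfq hgo hf0 hg0 hτ hφ
  obtain ⟨R, hR⟩ := hy.exists_le hφ T
  set R' : Fin n → ℝ := p ⊔ fun _ => R + d with hR'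
  have hbox : Icc 0 R' ⊆ W := fun z hz => hW hz.1
  obtain ⟨L₁, hL₁0, hL₁⟩ := exists_lipschitzBoundOn hWc hf isCompact_Icc hbox
  obtain ⟨L₂, hL₂0, hL₂⟩ := exists_lipschitzBoundOn hWc hg isCompact_Icc hbox
  set L : ℝ := L₁ + L₂ with hL
  have hfL := hL₁.of_le (by linarith : L₁ ≤ L)
  have hgL := hL₂.of_le (by linarith : L₂ ≤ L)
  -- With `v = y + ε * exp (K * t)`, the part `2 * L` of the rate pays for moving `f` and `g` from
  -- `y` to `v`, and the remaining `1` pays for the defect `-ε` of the near-subsolution `w`. The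
  -- choice of `ε` makes the perturbation `d / 4` at time `T`.
  set K : ℝ := 2 * L + 1 with hK
  have hKp : 0 < K := by positivity
  set ε : ℝ := d / 4 * Real.exp (-(K * T)) with hε
  have hεp : 0 < ε := by positivity
  have hεT : ∀ t, t ≤ T → ε * Real.exp (K * t) ≤ d / 4 := by
    intro t ht
    rw [hε, mul_assoc, ← Real.exp_add]
    have h1 : Real.exp (-(K * T) + K * t) ≤ 1 := by
      rw [Real.exp_le_one_iff]
      have := mul_le_mul_of_nonneg_left ht hKp.le
      linarith
    have := mul_le_mul_of_nonneg_left h1 (by positivity : 0 ≤ d / 4)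
    linarith
  obtain ⟨w, hxw, hwp, hFw, hFw'⟩ := exists_maximal_subequilibrium
    ((hf.continuousOn.add hg.continuousOn).mono hW) (hfq.add hgo.quasimonotoneOn) hxs hxp
    (ε := ε) (fun i => by simp [hFxs, hεp.le])
  have hw0 : 0 ≤ w := hxs.trans hxw
  set v : ℝ → (Fin n → ℝ) := fun t i => y t i + ε * Real.exp (K * t) with hv
  have hyv : ∀ t, y t ≤ v t := fun t i => by
    have : 0 < ε * Real.exp (K * t) := by positivity
    simp only [hv]; linarith
  have hyR : ∀ t ∈ Icc (-τmax) T, y t ∈ Icc 0 R' := fun t ht =>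
    ⟨hyn t ht.1, fun i => le_sup_of_le_right (by linarith [hR t ht i])⟩
  have hvR : ∀ t ∈ Icc (-τmax) T, v t ∈ Icc 0 R' := fun t ht =>
    ⟨(hyn t ht.1).trans (hyv t), fun i => le_sup_of_le_right
      (by simp only [hv]; linarith [hR t ht i, hεT t ht.2])⟩
  have hwv : w ≤ v T := by
    refine le_of_comparison (T := T) (x := fun _ => w) (y := v)
      (x' := fun _ _ => 0)
      (y' := fun t i => f (y t) i + g (delayed τ y i t) i + ε * (Real.exp (K * t) * K))
      hfq hgo hfL hgL hτ (fun t _ => ⟨hw0, le_sup_of_le_left hwp⟩) (fun t ht => (hvR t ht).1)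
      (fun t _ i => hasDerivWithinAt_const _ _ _) (fun t ht i => ?_) (fun t ht i => ?_)
      (fun t ht => ?_) T ⟨hT, le_rfl⟩
    · refine (hy.hasDeriv t ht.1 i).add ?_
      have := (((hasDerivAt_id t).const_mul K).exp.const_mul ε)
      simpa using this.hasDerivWithinAt
    · have htm : t ∈ Icc (-τmax) T := ⟨by linarith [hτ.bound_nonneg, ht.1], ht.2⟩
      have hsub : Icc (-τmax) t ⊆ Icc (-τmax) T := Icc_subset_Icc_right ht.2
      have hη : 0 ≤ ε * Real.exp (K * t) := by positivity
      have h1 := hfL _ (hvR t htm) _ (hyR t htm) _ hη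
        (fun j => by simp only [hv, add_sub_cancel_left]; exact (abs_of_nonneg hη).le) i
      have h2 := hgL _ (hτ.delayed_mem_Icc ht.1 (fun s hs => hvR s (hsub hs)) i) _
        (hτ.delayed_mem_Icc ht.1 (fun s hs => hyR s (hsub hs)) i) _ hη
        (fun j => by
          simp only [delayed, hv, add_sub_cancel_left]
          rw [abs_of_nonneg (by positivity)]
          have := (hτ.sub_mem i j ht.1).2
          gcongr) i
      have h3 : -ε ≤ f w i + g w i := hFw i
      have h4 : g (delayed τ (fun _ => w) i t) i = g w i := rfl
      have h5 : ε ≤ ε * Real.exp (K * t) :=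
        le_mul_of_one_le_right hεp.le (Real.one_le_exp (mul_nonneg hKp.le ht.1))
      have h6 : ε * (Real.exp (K * t) * K) =
          2 * (L * (ε * Real.exp (K * t))) + ε * Real.exp (K * t) := by rw [hK]; ring
      rw [h4, h6]
      linarith [(abs_le.1 h1).2, (abs_le.1 h2).2]
    · have h1 := hyv t
      rw [hy.initial t ht] at h1
      exact hwp.trans h1
  have hwd : ∀ i, w i ≤ xs i + d / 2 := fun i => by
    have h1 := hwv i
    simp only [hv] at h1
    linarith [hyT i, hεT T le_rfl]
  -- Comparison has forced `w` strictly below `p` in every component, so maximality gives equality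
  -- everywhere. Strictness `xs i < w i` follows, since equality would give `F w i ≥ F xs i = 0`.
  have hFeq : ∀ i, (f + g) w i = -ε := fun i =>
    hFw' i (by simp only [hp]; linarith [hwd i])
  refine ⟨w, fun i => ?_, fun i => by linarith [hwd i], fun i => by
    rw [hFeq i]; exact neg_nonpos.2 hεp.le⟩
  refine (hxw i).lt_of_ne fun heq => ?_
  have := (hfq.add hgo.quasimonotoneOn) xs hxs w hw0 hxw i heq
  rw [hFxs, hFeq, Pi.zero_apply] at this
  linarith

theorem SubHomogeneousOn.add (hfs : SubHomogeneousOn f α (orthant n))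
    (hgs : SubHomogeneousOn g α (orthant n)) : SubHomogeneousOn (f + g) α (orthant n) :=
  fun x hx c hc i => by
    have h1 := hfs x hx c hc i
    have h2 := hgs x hx c hc i
    simp only [Pi.add_apply]
    linarith

/-- Global asymptotic stability for one choice of delays carries over to every other choice. -/
theorem IsGAS.of_isGAS (hWc : Convex ℝ W) (hW : orthant n ⊆ W)
    (hf : ContDiffOn ℝ 1 f W) (hg : ContDiffOn ℝ 1 g W)
    (hfq : QuasimonotoneOn f (orthant n)) (hgo : OrderPreservingOn g (orthant n))
    (hα : 0 < α) (hfs : SubHomogeneousOn f α (orthant n))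
    (hgs : SubHomogeneousOn g α (orthant n)) (hτ : IsDelay τmax τ)
    (h : IsGAS W f g τmax τ xs) {σmax : ℝ} {σ : Fin n → Fin n → ℝ → ℝ}
    (hσ : IsDelay σmax σ) : IsGAS W f g σmax σ xs := by
  have hf0 := hfs.zero_nonneg hα
  have hg0 := hgs.zero_nonneg hα
  have hxs : 0 ≤ xs := h.mem_orthant
  have hFs := hfs.add hgs
  have hFq := hfq.add hgo.quasimonotoneOn
  have hfc := hf.continuousOn.mono hW
  have hgc := hg.continuousOn.mono hW
  have hsup : ∀ d : ℝ, 0 < d → ∃ w : Fin n → ℝ, (∀ i, xs i < w i) ∧ (∀ i, w i ≤ xs i + d) ∧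
      (f + g) w ≤ 0 :=
    fun d hd => h.exists_superequilibrium hWc hW hf hg hfq hgo hf0 hg0 hτ hd
  have habove : ∀ φ : ℝ → (Fin n → ℝ), IsInitial σmax φ → ∃ w : Fin n → ℝ, 0 ≤ w ∧
      (f + g) w ≤ 0 ∧ ∀ t ∈ Icc (-σmax) 0, φ t ≤ w := by
    intro φ hφ
    obtain ⟨w, hxw, -, hFw⟩ := hsup 1 one_pos
    have hwp : ∀ i, 0 < w i := fun i => (hxs i).trans_lt (hxw i)
    obtain ⟨m, hm, hmw⟩ := exists_pos_forall_le w hwp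
    obtain ⟨R, hR⟩ := (isCompact_Icc.image_of_continuousOn hφ.1).isBounded.exists_norm_le
    set c : ℝ := max 1 (R / m) with hc
    have hc1 : 1 ≤ c := le_max_left _ _
    refine ⟨c • w, fun i => mul_nonneg (by linarith) (hwp i).le, fun i => ?_, fun t ht i => ?_⟩
    · exact (hFs w (fun i => (hwp i).le) c hc1 i).trans
        (mul_nonpos_of_nonneg_of_nonpos (by positivity) (hFw i))
    · calc φ t i ≤ R := (le_abs_self _).trans
            ((norm_le_pi_norm (φ t) i).trans (hR _ (mem_image_of_mem _ ht)))
        _ = R / m * m := by field_simp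
        _ ≤ c * w i := mul_le_mul (le_max_right _ _) (hmw i) hm.le (by linarith)
  refine ⟨h.mem_orthant, h.equilibrium, fun ε hε => ?_, fun φ hφ => ?_, fun φ x hφ hx => ?_⟩
  · obtain ⟨w, hxw, hwε, hFw⟩ := hsup (ε / 2) (half_pos hε)
    -- This gives `μ < 1` and `μ * xs i ≤ ε / 2`. The vector `v = (1 - μ) • xs` is a subsolution,
    -- because `0 = F xs ≤ (1 - μ)⁻¹ ^ α * F v`.
    set μ : ℝ := ε / 2 / (‖xs‖ + ε) with hμ
    have hμp : 0 < μ := by positivity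
    have hμ1 : μ < 1 := by
      rw [hμ, div_lt_one (by positivity)]
      linarith [norm_nonneg xs]
    have hμx : ∀ i, μ * xs i ≤ ε / 2 := fun i => by
      have h1 : xs i ≤ ‖xs‖ + ε := by
        linarith [(le_abs_self (xs i)).trans (norm_le_pi_norm xs i)]
      calc μ * xs i ≤ μ * (‖xs‖ + ε) := by gcongr
        _ = ε / 2 := by rw [hμ]; field_simp
    set v : Fin n → ℝ := (1 - μ) • xs with hv
    have hvi : ∀ i, v i = xs i - μ * xs i := fun i => by
      simp only [hv, Pi.smul_apply, smul_eq_mul]; ring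
    have hv0 : 0 ≤ v := smul_nonneg (by linarith) hxs
    have hFv : 0 ≤ (f + g) v := by
      intro i
      have h1 : 1 ≤ (1 - μ)⁻¹ := (one_le_inv₀ (by linarith)).2 (by linarith)
      have h2 := hFs v hv0 _ h1 i
      rw [hv, smul_smul, inv_mul_cancel₀ (by linarith), one_smul,
        show (f + g) xs = 0 from h.equilibrium] at h2
      exact nonneg_of_mul_nonneg_right h2 (Real.rpow_pos_of_pos (by linarith) _)
    obtain ⟨δ, hδ, hδle⟩ := exists_pos_forall_le
      (fun i => min (w i - xs i) (if 0 < xs i then μ * xs i else 1)) (fun i => by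
        refine lt_min (sub_pos.2 (hxw i)) ?_
        split_ifs with hi
        · exact mul_pos hμp hi
        · exact one_pos)
    refine ⟨δ, hδ, fun φ x hφ hφδ hx t ht => ?_⟩
    have hmem := hx.mem_Icc hWc hW hf hg hfq hgo hf0 hg0 hσ hφ hv0
      (fun i => (hxs i).trans (hxw i).le) hFv hFw (fun r hr => by
        have hclose : ∀ i, |φ r i - xs i| ≤ δ := fun i =>
          (norm_le_pi_norm (φ r - xs) i).trans (hφδ r hr).le
        refine ⟨fun i => ?_, fun i => ?_⟩
        · have h1 := (hδle i).trans (min_le_right _ _)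
          have h2 := (abs_le.1 (hclose i)).1
          rw [hvi]
          split_ifs at h1 with hi
          · linarith
          · have h3 : 0 ≤ φ r i := hφ.2 r hr i
            have h4 : xs i = 0 := le_antisymm (not_lt.1 hi) (hxs i)
            rw [h4]; linarith
        · have h1 := (hδle i).trans (min_le_left _ _)
          linarith [(abs_le.1 (hclose i)).2]) t
      ((neg_nonpos.2 hσ.bound_nonneg).trans ht)
    refine lt_of_le_of_lt ((pi_norm_le_iff_of_nonneg (half_pos hε).le).2 fun i => ?_)
      (half_lt_self hε)
    have h1 := hmem.1 i
    have h2 := hmem.2 i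
    rw [hvi] at h1
    rw [Real.norm_eq_abs, Pi.sub_apply, abs_le]
    exact ⟨by linarith [hμx i], by linarith [hwε i]⟩
  · obtain ⟨w, hw, hFw, hφw⟩ := habove φ hφ
    exact exists_isSolution_of_superequilibrium hWc hW hf hg hfq hgo hf0 hg0 hσ hφ hw hFw hφw
  · obtain ⟨w, hw, hFw, hφw⟩ := habove φ hφ
    have hmem := hx.mem_Icc hWc hW hf hg hfq hgo hf0 hg0 hσ hφ le_rfl hw (add_nonneg hf0 hg0) hFw
      fun t ht => ⟨hφ.2 t ht, hφw t ht⟩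
    have hmem' : ∀ᶠ t in atTop, x t ∈ Icc 0 w := by
      filter_upwards [eventually_ge_atTop (-σmax)] with t ht using hmem t ht
    have hbl : ∀ i, IsBoundedUnder (· ≤ ·) atTop fun t => x t i :=
      fun i => ⟨w i, eventually_map.2 (hmem'.mono fun t ht => ht.2 i)⟩
    have hbg : ∀ i, IsBoundedUnder (· ≥ ·) atTop fun t => x t i :=
      fun i => ⟨0, eventually_map.2 (hmem'.mono fun t ht => ht.1 i)⟩
    set s : Fin n → ℝ := fun i => limsup (fun t => x t i) atTop with hs
    set l : Fin n → ℝ := fun i => liminf (fun t => x t i) atTop with hl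
    have hl0 : 0 ≤ l := fun i =>
      le_liminf_of_le (hbl i).isCoboundedUnder_ge (hmem'.mono fun t ht => ht.1 i)
    have hls : l ≤ s := fun i => liminf_le_limsup (hbl i) (hbg i)
    have hsw : s ≤ w := fun i =>
      limsup_le_of_le (hbg i).isCoboundedUnder_le (hmem'.mono fun t ht => ht.2 i)
    have hFs0 : 0 ≤ (f + g) s := nonneg_of_limsup hfc hgc hfq hgo hσ (fun t ht => (hmem t ht).1)
      hx.hasDeriv (hl0.trans hls)
      (fun ρ hρ j => eventually_lt_of_limsup_lt (lt_add_of_pos_right _ hρ) (hbl j))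
      (fun ρ hρ j => frequently_lt_of_lt_limsup (hbg j).isCoboundedUnder_le (sub_lt_self _ hρ))
    have hFl0 : (f + g) l ≤ 0 := nonpos_of_liminf hfc hgc hfq hgo hσ (fun t ht => (hmem t ht).1)
      hx.hasDeriv hl0
      (fun ρ hρ j => eventually_lt_of_lt_liminf (sub_lt_self _ hρ) (hbg j))
      (fun ρ hρ j => frequently_lt_of_liminf_lt (hbl j).isCoboundedUnder_ge
        (lt_add_of_pos_right _ hρ))
    have hsxs : s ≤ xs := by
      -- With `ε = 0` the maximal point is an equilibrium: in components where it meets `w`,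
      -- quasimonotonicity gives `F w' i ≤ F w i ≤ 0`.
      obtain ⟨w', hsw', hw'w, hFw', hFeq⟩ := exists_maximal_subequilibrium (hfc.add hgc) hFq
        (hl0.trans hls) hsw (ε := 0) (fun i => by rw [neg_zero]; exact hFs0 i)
      have hw'0 : 0 ≤ w' := (hl0.trans hls).trans hsw'
      rw [← h.eq_of_equilibrium hW hw'0 (funext fun i => ?_)]
      · exact hsw'
      · rcases (hw'w i).lt_or_eq with hi | hi
        · rw [hFeq i hi, neg_zero, Pi.zero_apply]
        · refine le_antisymm ((hFq w' hw'0 w hw hw'w i hi).trans (hFw i)) ?_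
          have := hFw' i
          rwa [neg_zero] at this
    have hxsl : xs ≤ l := by
      -- Here the components with `m i = 0` are settled by `F 0 ≥ 0` and quasimonotonicity.
      obtain ⟨m, hm0, hFm, hml, hFeq⟩ := exists_minimal_superequilibrium (hfc.add hgc) hFq hl0 hFl0
      rw [← h.eq_of_equilibrium hW hm0 (funext fun i => ?_)]
      · exact hml
      · rcases (hm0 i).lt_or_eq with hi | hi
        · exact hFeq i hi
        · exact le_antisymm (hFm i) (hFq.nonneg_of_eq_zero (add_nonneg hf0 hg0) hm0 hi.symm)
    exact tendsto_pi_nhds.2 fun i =>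
      tendsto_of_le_liminf_of_limsup_le (hxsl i) (hsxs i) (hbl i) (hbg i)

end DelaySystem

theorem theorem2 {n : ℕ} (W : Set (Fin n → ℝ)) (hWo : IsOpen W) (hWc : Convex ℝ W)
    (hW : DelaySystem.orthant n ⊆ W) (f g : (Fin n → ℝ) → (Fin n → ℝ))
    (hf : ContDiffOn ℝ 1 f W) (hg : ContDiffOn ℝ 1 g W)
    (hfc : DelaySystem.CooperativeOn f (DelaySystem.orthant n))
    (hgo : DelaySystem.OrderPreservingOn g (DelaySystem.orthant n))
    (α : ℝ) (hα : 0 < α)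
    (hfs : DelaySystem.SubHomogeneousOn f α (DelaySystem.orthant n))
    (hgs : DelaySystem.SubHomogeneousOn g α (DelaySystem.orthant n))
    (xs : Fin n → ℝ) :
    [ -- the system without delay
      DelaySystem.IsGAS W f g 0 (fun _ _ _ => 0) xs,
      -- the system with every choice of bounded delays
      ∀ (τmax : ℝ) (τ : Fin n → Fin n → ℝ → ℝ), DelaySystem.IsDelay τmax τ →
        DelaySystem.IsGAS W f g τmax τ xs,
      -- the system with some choice of bounded delays
      ∃ (τmax : ℝ) (τ : Fin n → Fin n → ℝ → ℝ), DelaySystem.IsDelay τmax τ ∧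
        DelaySystem.IsGAS W f g τmax τ xs ].TFAE := by
  have h0 : DelaySystem.IsDelay (n := n) 0 (fun _ _ _ => 0) :=
    ⟨le_rfl, fun _ _ => continuousOn_const, fun _ _ _ _ => le_rfl, fun _ _ _ _ => le_rfl⟩
  tfae_have 2 → 1 := fun h => h 0 _ h0
  tfae_have 1 → 3 := fun h => ⟨0, _, h0, h⟩
  tfae_have 3 → 2 := by
    rintro ⟨τmax, τ, hτ, h⟩ σmax σ hσ
    exact h.of_isGAS hWc hW hf hg (hfc.quasimonotoneOn hWo hW hf) hgo hα hfs hgs hτ hσ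
  tfae_finish
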